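/- Let $n>1$ be an integer and let $\mathfrak{C}_n=\{0,1,\dots,n-1\}^{\omega}$ be the Cantor set, viewed as the boundary of the infinite rooted $n$-ary tree. Let $V_n$ be the Higman--Thompson group: the group, under composition, of all homeomorphisms $f$ of $\mathfrak{C}_n$ for which there are two finite rooted $n$-ary trees $A$, $B$ (every vertex is a leaf or has exactly $n$ ordered children) and a bijection $\sigma$ from the leaves of $A$ to the leaves of $B$ such that $f(ux)=\sigma(u)x$ for every leaf $u$ of $A$ and every $x\in\mathfrak{C}_n$, where a leaf is identified with the finite word over $\{0,\dots,n-1\}$ that describes the path from the root to it. Then, for every $\alpha\in V_n$, the centralizer $C_{V_n}(\alpha)=\{\beta\in V_n\mid \alpha\beta=\beta\alpha\}$ is a finitely generated group. -/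

import Mathlib

namespace HigmanThompson

/-- The Cantor set `𝔠_n = {0, …, n-1}^ω`, the boundary of the infinite rooted regular `n`-ary tree,
with the product topology (each factor being discrete). -/
abbrev Cantor (n : ℕ) : Type := ℕ → Fin n

/-- The infinite word with first letter `i` and remaining letters `x`. -/
def cons {n : ℕ} (i : Fin n) (x : Cantor n) : Cantor n
  | 0 => i
  | k + 1 => x k

/-- `prepend u x` is the infinite word `u x`. A finite word `u` is (the name of) a node of the
infinite `n`-ary tree, and the points `prepend u x` are those of the Cantor set under this node. -/
def prepend {n : ℕ} : List (Fin n) → Cantor n → Cantor n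
  | [], x => x
  | i :: u, x => cons i (prepend u x)

/-- Finite rooted `n`-ary trees: every vertex is a leaf or has exactly `n` ordered children. -/
inductive NTree (n : ℕ) : Type
  | leaf : NTree n
  | caret (children : Fin n → NTree n) : NTree n

/-- The set of (names of) leaves of a finite rooted `n`-ary tree. -/
def NTree.leaves {n : ℕ} : NTree n → Set (List (Fin n))
  | .leaf => {[]}
  | .caret c => {u | ∃ i, ∃ v ∈ (c i).leaves, u = i :: v}

/-- A tree pair `(A, B, σ)`: two finite rooted `n`-ary trees and a bijection from the leaves of `A`
to the leaves of `B` (so both have the same number `m` of leaves; numbering the leaves from left to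
right turns `σ` into a permutation of `{1, …, m}`). -/
structure TreePair (n : ℕ) : Type where
  A : NTree n
  B : NTree n
  σ : A.leaves ≃ B.leaves

/-- The tree pair `(A, B, σ)` represents `f` if, for every leaf `u` of `A`, the map `f` carries the
Cantor set under `u` to the one under the leaf `σ u` of `B` in the canonical (affine, order
preserving) way, that is, by replacing the prefix `u` by `σ u`. -/
def TreePair.Represents {n : ℕ} (P : TreePair n) (f : Cantor n ≃ₜ Cantor n) : Prop :=
  ∀ (u : P.A.leaves) (x : Cantor n), f (prepend u x) = prepend (P.σ u) x

/-! ### Helper facts: the maps represented by tree pairs form a group -/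

theorem cons_inj {n : ℕ} {i j : Fin n} {x y : Cantor n} (h : cons i x = cons j y) :
    i = j ∧ x = y :=
  ⟨congrFun h 0, funext fun k => congrFun h (k + 1)⟩

theorem cons_eta {n : ℕ} (x : Cantor n) : cons (x 0) (fun k => x (k + 1)) = x := by
  funext k
  cases k <;> rfl

theorem prepend_append {n : ℕ} (u v : List (Fin n)) (x : Cantor n) :
    prepend (u ++ v) x = prepend u (prepend v x) := by
  induction u with
  | nil => rfl
  | cons i u ih => simp [prepend, ih]

/-- Two prefixes of the same infinite word are comparable. -/
theorem prepend_compare {n : ℕ} (u v : List (Fin n)) (x y : Cantor n)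
    (h : prepend u x = prepend v y) :
    (∃ t, v = u ++ t ∧ x = prepend t y) ∨ (∃ t, u = v ++ t ∧ y = prepend t x) := by
  induction u generalizing v with
  | nil => exact Or.inl ⟨v, rfl, h⟩
  | cons i u ih =>
    cases v with
    | nil => exact Or.inr ⟨i :: u, rfl, h.symm⟩
    | cons j v =>
      obtain ⟨rfl, h'⟩ := cons_inj h
      rcases ih v h' with ⟨t, rfl, ht⟩ | ⟨t, rfl, ht⟩
      · exact Or.inl ⟨t, rfl, ht⟩
      · exact Or.inr ⟨t, rfl, ht⟩

/-- Every point lies under some leaf. -/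
theorem NTree.exists_leaf {n : ℕ} (T : NTree n) (x : Cantor n) :
    ∃ u ∈ T.leaves, ∃ y, x = prepend u y := by
  induction T generalizing x with
  | leaf => exact ⟨[], rfl, x, rfl⟩
  | caret c ih =>
    obtain ⟨u, hu, y, hy⟩ := ih (x 0) (fun k => x (k + 1))
    refine ⟨x 0 :: u, ⟨x 0, u, hu, rfl⟩, y, ?_⟩
    rw [prepend, ← hy, cons_eta]

/-- A point lies under one leaf only. -/
theorem NTree.leaf_unique {n : ℕ} (T : NTree n) {u v : List (Fin n)} (hu : u ∈ T.leaves)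
    (hv : v ∈ T.leaves) {x y : Cantor n} (h : prepend u x = prepend v y) : u = v := by
  induction T generalizing u v with
  | leaf =>
    have h1 : u = [] := hu
    have h2 : v = [] := hv
    rw [h1, h2]
  | caret c ih =>
    obtain ⟨i, u, hu, rfl⟩ := hu
    obtain ⟨j, v, hv, rfl⟩ := hv
    obtain ⟨rfl, h'⟩ := cons_inj h
    rw [ih i hu hv h']

/-- If every infinite word has a prefix satisfying `P`, then some finite tree has all its leaves
satisfying `P`. -/
theorem exists_tree {n : ℕ} (P : List (Fin n) → Prop)
    (hP : ∀ x : Cantor n, ∃ u y, x = prepend u y ∧ P u) :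
    ∃ T : NTree n, ∀ u ∈ T.leaves, P u := by
  by_contra hbad
  let Bad := {Q : List (Fin n) → Prop // ¬ ∃ T : NTree n, ∀ u ∈ T.leaves, Q u}
  have step : ∀ Q : Bad, ∃ i : Fin n,
      ¬ ∃ T : NTree n, ∀ u ∈ T.leaves, Q.1 (i :: u) := by
    intro Q
    by_contra! hcon
    choose c hc using hcon
    refine Q.2 ⟨.caret c, ?_⟩
    rintro _ ⟨i, v, hv, rfl⟩
    exact hc i v hv
  choose next hnext using step
  let seq : ℕ → Bad := fun k =>
    Nat.rec ⟨P, hbad⟩ (fun _ Q => ⟨fun u => Q.1 (next Q :: u), hnext Q⟩) k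
  have key : ∀ (u : List (Fin n)) (y : Cantor n) (k : ℕ),
      (fun j => next (seq (k + j))) = prepend u y → ¬ (seq k).1 u := by
    intro u
    induction u with
    | nil =>
      intro y k _ h
      refine (seq k).2 ⟨.leaf, fun u hu => ?_⟩
      have hu' : u = [] := hu
      rw [hu']
      exact h
    | cons i u ih =>
      intro y k hk h
      have h0 : next (seq k) = i := congrFun hk 0
      refine ih y (k + 1) ?_ ?_
      · funext j
        have := congrFun hk (j + 1)
        rw [show k + 1 + j = k + (j + 1) by omega]
        exact this
      · change (seq k).1 (next (seq k) :: u)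
        rw [h0]
        exact h
  obtain ⟨u, y, hx, hu⟩ := hP (fun j => next (seq (0 + j)))
  exact key u y 0 hx hu

/-- A complete prefix code is the set of leaves of a finite tree, as soon as some finite tree
refines it. -/
theorem exists_tree_leaves_eq {n : ℕ} [NeZero n] (T : NTree n) (S : Set (List (Fin n)))
    (hex : ∀ x : Cantor n, ∃ u ∈ S, ∃ y, x = prepend u y)
    (huniq : ∀ u ∈ S, ∀ v ∈ S, ∀ x y : Cantor n, prepend u x = prepend v y → u = v)
    (hT : ∀ u ∈ T.leaves, ∃ s ∈ S, s <+: u) : ∃ B : NTree n, B.leaves = S := by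
  have triv : [] ∈ S → ∃ B : NTree n, B.leaves = S := by
    intro h0
    refine ⟨.leaf, Set.ext fun u => ⟨fun hu => ?_, fun hu => ?_⟩⟩
    · have hu' : u = [] := hu
      rwa [hu']
    · exact (huniq [] h0 u hu (prepend u fun _ => 0) (fun _ => 0) rfl).symm
  induction T generalizing S with
  | leaf =>
    obtain ⟨s, hs, hs'⟩ := hT [] rfl
    rw [List.prefix_nil.1 hs'] at hs
    exact triv hs
  | caret c ih =>
    by_cases h0 : [] ∈ S
    · exact triv h0
    have main : ∀ i : Fin n, ∃ B : NTree n, B.leaves = {u | i :: u ∈ S} := by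
      intro i
      have huniq' : ∀ u ∈ {u | i :: u ∈ S}, ∀ v ∈ {u | i :: u ∈ S}, ∀ x y : Cantor n,
          prepend u x = prepend v y → u = v := by
        intro u hu v hv x y h
        have := huniq (i :: u) hu (i :: v) hv x y (by rw [prepend, h, prepend])
        simpa using this
      refine ih i _ ?_ huniq' ?_ ?_
      · intro x
        obtain ⟨u, hu, y, hy⟩ := hex (cons i x)
        cases u with
        | nil => exact absurd hu h0
        | cons j u =>
          obtain ⟨rfl, h⟩ := cons_inj hy
          exact ⟨u, hu, y, h⟩
      · intro u hu
        obtain ⟨s, hs, hs'⟩ := hT (i :: u) ⟨i, u, hu, rfl⟩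
        cases s with
        | nil => exact absurd hs h0
        | cons j s =>
          obtain ⟨rfl, h⟩ := List.cons_prefix_cons.1 hs'
          exact ⟨s, hs, h⟩
      · intro h1
        refine ⟨.leaf, Set.ext fun u => ⟨fun hu => ?_, fun hu => ?_⟩⟩
        · have hu' : u = [] := hu
          rwa [hu']
        · exact (huniq' [] h1 u hu (prepend u fun _ => 0) (fun _ => 0) rfl).symm
    choose B hB using main
    refine ⟨.caret B, Set.ext fun u => ⟨?_, fun hu => ?_⟩⟩
    · rintro ⟨i, v, hv, rfl⟩
      rw [hB] at hv
      exact hv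
    · cases u with
      | nil => exact absurd hu h0
      | cons i u => exact ⟨i, u, by rw [hB]; exact hu, rfl⟩

/-- Every point has a neighbourhood, the Cantor set under some node, on which `f` replaces a
prefix. -/
def IsLocal {n : ℕ} (f : Cantor n ≃ₜ Cantor n) : Prop :=
  ∀ x, ∃ u v y, x = prepend u y ∧ ∀ z, f (prepend u z) = prepend v z

theorem IsLocal.mul {n : ℕ} {f g : Cantor n ≃ₜ Cantor n} (hf : IsLocal f) (hg : IsLocal g) :
    IsLocal (f * g) := by
  intro x
  obtain ⟨u, v, y, hx, hu⟩ := hg x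
  obtain ⟨u', v', y', hx', hu'⟩ := hf (g x)
  have h : prepend v y = prepend u' y' := by rw [← hx', hx, hu]
  rcases prepend_compare _ _ _ _ h with ⟨t, rfl, rfl⟩ | ⟨t, rfl, rfl⟩
  · refine ⟨u ++ t, v', y', by rw [prepend_append, hx], fun z => ?_⟩
    change f (g _) = _
    rw [prepend_append, hu, ← prepend_append, hu']
  · refine ⟨u, v' ++ t, y, hx, fun z => ?_⟩
    change f (g _) = _
    rw [hu, prepend_append, hu', prepend_append]

theorem TreePair.Represents.isLocal {n : ℕ} {P : TreePair n} {f : Cantor n ≃ₜ Cantor n}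
    (h : P.Represents f) : IsLocal f := by
  intro x
  obtain ⟨u, hu, y, hy⟩ := P.A.exists_leaf x
  exact ⟨u, P.σ ⟨u, hu⟩, y, hy, fun z => h ⟨u, hu⟩ z⟩

theorem exists_represents_one (n : ℕ) : ∃ P : TreePair n, P.Represents 1 :=
  ⟨⟨.leaf, .leaf, Equiv.refl _⟩, fun _ _ => rfl⟩

theorem IsLocal.exists_represents {n : ℕ} {f : Cantor n ≃ₜ Cantor n} (hf : IsLocal f) :
    ∃ P : TreePair n, P.Represents f := by
  rcases Nat.eq_zero_or_pos n with rfl | hn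
  · have : f = 1 := Homeomorph.ext fun x => (x 0).elim0
    rw [this]
    exact exists_represents_one 0
  have : NeZero n := ⟨hn.ne'⟩
  obtain ⟨A, hA⟩ := exists_tree (fun u => ∃ v, ∀ z, f (prepend u z) = prepend v z) (by
    intro x
    obtain ⟨u, v, y, hx, hu⟩ := hf x
    exact ⟨u, y, hx, v, hu⟩)
  choose! v hv using hA
  have hex : ∀ x : Cantor n, ∃ s ∈ v '' A.leaves, ∃ y, x = prepend s y := by
    intro x
    obtain ⟨u, hu, y, hy⟩ := A.exists_leaf (f.symm x)
    refine ⟨v u, ⟨u, hu, rfl⟩, y, ?_⟩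
    rw [← hv u hu, ← hy, f.apply_symm_apply]
  have huniq : ∀ u ∈ A.leaves, ∀ u' ∈ A.leaves, ∀ x y : Cantor n,
      prepend (v u) x = prepend (v u') y → u = u' := by
    intro u hu u' hu' x y h
    rw [← hv u hu, ← hv u' hu'] at h
    exact A.leaf_unique hu hu' (f.injective h)
  obtain ⟨T, hT⟩ := exists_tree (fun w => ∃ s ∈ v '' A.leaves, s <+: w) (by
    intro x
    obtain ⟨s, hs, y, hy⟩ := hex x
    exact ⟨s, y, hy, s, hs, List.prefix_refl s⟩)
  obtain ⟨B, hB⟩ := exists_tree_leaves_eq T (v '' A.leaves) hex (by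
    rintro _ ⟨u, hu, rfl⟩ _ ⟨u', hu', rfl⟩ x y h
    rw [huniq u hu u' hu' x y h]) hT
  have hinj : Set.InjOn v A.leaves := fun u hu u' hu' h =>
    huniq u hu u' hu' (fun _ => 0) (fun _ => 0) (by rw [h])
  have hbij : Set.BijOn v A.leaves B.leaves := by
    rw [hB]
    exact hinj.bijOn_image
  exact ⟨⟨A, B, hbij.equiv v⟩, fun u x => hv u u.2 x⟩

/-- The Higman–Thompson group `V_n`: the group, under composition, of all homeomorphisms of the
Cantor set that are represented by a tree pair. -/
def V (n : ℕ) : Subgroup (Cantor n ≃ₜ Cantor n) where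
  carrier := {f | ∃ P : TreePair n, P.Represents f}
  one_mem' := exists_represents_one n
  mul_mem' := by
    rintro f g ⟨P, hP⟩ ⟨Q, hQ⟩
    exact (hP.isLocal.mul hQ.isLocal).exists_represents
  inv_mem' := by
    rintro f ⟨P, hP⟩
    refine ⟨⟨P.B, P.A, P.σ.symm⟩, fun u x => ?_⟩
    have h := hP (P.σ.symm u) x
    rw [Equiv.apply_symm_apply] at h
    change f.symm _ = _
    rw [← h, f.symm_apply_apply]

end HigmanThompson

/-!
Write `f` for a given local permutation of the Cantor set, that is, one that replaces a prefix near
each point; these permutations are the elements of `V n`. There are three kinds of points for `f`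
(`isRepelling_or_isTorsionAt_or_isAttracted`): torsion points, near which a positive power of `f` is
the identity; points whose forward orbit enters a cone that is contracted by a power of `f`; and
periodic points that are repelling. To see this, follow the prefixes of `x` under the iterates of
`f`. If some prefix is replaced by all iterates, its images either recur or grow, and only a bounded
block at their beginning governs their growth, so that a block recurs. If not, the iterates eat up
all prefixes of `x`, and then read backwards `f⁻¹` contracts a cone to an orbit containing `x`.
Consequently the torsion points form a clopen set, and there are finitely many repelling points.

The centralizer of `f` permutes the repelling points. On the stabilizer of all of them, the germs at
these points give a homomorphism to a free abelian group of finite rank. An element of its kernel is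
the identity near the repelling points, and hence outside the torsion part, since the backward
orbits of almost all other points accumulate at repelling points (`mem_torsionCentralizer`). So it
suffices that the group of the elements supported on the torsion part is finitely generated
(`fg_localCentralizer`).

The torsion part is partitioned by the cones of finitely many words that `f` permutes, so that `f`
acts on it as `a × id` acts on `ι × Cantor n`, for a permutation `a` of a finite set `ι`
(`exists_equiv_torsion`). It remains to generate the group of the local permutations of
`ι × Cantor n` that commute with `a × id` (`fg_equivariantPerm`). Swaps of two orbits of nodes, and
powers of `a` on one orbit, generate it: such swaps move the images of the nodes of a fixed level
`d` up until they all have level `d`, and then put them in order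
(`mem_boundedClosure_of_level_le`, `mem_boundedClosure_of_level_eq`). Finitely many of these
elements suffice, since two nodes can be conjugated to nodes of level at most `2` by swaps of nodes
of level at most `3` (`orbitPerms_subset`).
-/

namespace HigmanThompson

open Equiv

variable {n : ℕ}

/-! ### Words and cones -/

/-- The set of infinite words with prefix `u`. -/
def cone (u : List (Fin n)) : Set (Cantor n) := Set.range (prepend u)

/-- The prefix of length `k` of an infinite word. -/
def pre : Cantor n → ℕ → List (Fin n)
  | _, 0 => []
  | x, k + 1 => x 0 :: pre (fun i => x (i + 1)) k

@[simp] theorem length_pre (x : Cantor n) (k : ℕ) : (pre x k).length = k := by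
  induction k generalizing x with
  | zero => rfl
  | succ k ih => simp [pre, ih]

theorem mem_cone_pre (x : Cantor n) (k : ℕ) : x ∈ cone (pre x k) := by
  induction k generalizing x with
  | zero => exact ⟨x, rfl⟩
  | succ k ih =>
    obtain ⟨z, hz⟩ := ih (fun i => x (i + 1))
    exact ⟨z, by rw [pre, prepend, hz, cons_eta]⟩

theorem prepend_mem_cone (u : List (Fin n)) (z : Cantor n) : prepend u z ∈ cone u := ⟨z, rfl⟩

theorem prepend_injective (u : List (Fin n)) : Function.Injective (prepend u) := by
  induction u with
  | nil => exact fun x y h => h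
  | cons i u ih => exact fun x y h => ih (cons_inj h).2

theorem cone_append_subset (u t : List (Fin n)) : cone (u ++ t) ⊆ cone u := by
  rintro _ ⟨z, rfl⟩
  exact ⟨prepend t z, (prepend_append u t z).symm⟩

theorem exists_eq_append_of_mem_cone {u v : List (Fin n)} {x : Cantor n} (hu : x ∈ cone u)
    (hv : x ∈ cone v) (h : u.length ≤ v.length) : ∃ t, v = u ++ t := by
  obtain ⟨y, rfl⟩ := hu
  obtain ⟨z, hz⟩ := hv
  rcases prepend_compare _ _ _ _ hz with ⟨t, rfl, -⟩ | ⟨t, rfl, -⟩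
  · rw [List.length_append] at h
    have : t = [] := List.length_eq_zero_iff.1 (by omega)
    exact ⟨[], by simp [this]⟩
  · exact ⟨t, rfl⟩

theorem eq_of_mem_cone {u v : List (Fin n)} {x : Cantor n} (hu : x ∈ cone u)
    (hv : x ∈ cone v) (h : u.length = v.length) : u = v := by
  obtain ⟨t, rfl⟩ := exists_eq_append_of_mem_cone hu hv h.le
  rw [List.length_append] at h
  have : t = [] := List.length_eq_zero_iff.1 (by omega)
  simp [this]

theorem eq_pre_of_mem_cone {u : List (Fin n)} {x : Cantor n} (hu : x ∈ cone u) :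
    u = pre x u.length :=
  eq_of_mem_cone hu (mem_cone_pre x _) (by simp)

theorem apply_eq_of_pre_eq {x y : Cantor n} {k i : ℕ} (h : pre x k = pre y k) (hi : i < k) :
    x i = y i := by
  induction k generalizing x y i with
  | zero => omega
  | succ k ih =>
    simp only [pre, List.cons.injEq] at h
    cases i with
    | zero => exact h.1
    | succ i => exact ih (x := fun i => x (i + 1)) (y := fun i => y (i + 1)) h.2 (by omega)

theorem eq_of_arbitrarily_long {x y : Cantor n}
    (h : ∀ k, ∃ u : List (Fin n), k ≤ u.length ∧ x ∈ cone u ∧ y ∈ cone u) : x = y := by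
  funext i
  obtain ⟨u, hk, hx, hy⟩ := h (i + 1)
  refine apply_eq_of_pre_eq (k := u.length) ?_ (by omega)
  rw [← eq_pre_of_mem_cone hx, ← eq_pre_of_mem_cone hy]

theorem prepend_apply_of_lt (u : List (Fin n)) (x : Cantor n) (k : ℕ) (h : k < u.length) :
    prepend u x k = u[k] := by
  induction u generalizing k with
  | nil => simp at h
  | cons i u ih =>
    cases k with
    | zero => rfl
    | succ k => exact ih k (by simpa using h)

theorem prepend_apply_of_le (u : List (Fin n)) (x : Cantor n) (k : ℕ) :
    prepend u x (u.length + k) = x k := by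
  induction u with
  | nil => simp [prepend]
  | cons i u ih =>
    rw [List.length_cons, show u.length + 1 + k = (u.length + k) + 1 by omega]
    exact ih

theorem exists_prepend_eq_self {e : List (Fin n)} (he : e ≠ []) : ∃ q, prepend e q = q := by
  have hpos : 0 < e.length := List.length_pos_iff.2 he
  refine ⟨fun k => e[k % e.length]'(Nat.mod_lt _ hpos), funext fun k => ?_⟩
  by_cases hk : k < e.length
  · rw [prepend_apply_of_lt _ _ _ hk]
    simp [Nat.mod_eq_of_lt hk]
  · obtain ⟨j, rfl⟩ := Nat.exists_eq_add_of_le (not_lt.1 hk)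
    rw [prepend_apply_of_le]
    simp

/-- The compactness of the Cantor set: a property of words that passes to extensions, and holds for
some prefix of each infinite word, holds for all words that are long enough. -/
theorem exists_length_forall (P : List (Fin n) → Prop) (hmono : ∀ u t, P u → P (u ++ t))
    (hP : ∀ x, ∃ u, x ∈ cone u ∧ P u) : ∃ D, ∀ u : List (Fin n), D ≤ u.length → P u := by
  obtain ⟨T, hT⟩ := exists_tree P (by
    intro x
    obtain ⟨u, ⟨z, hz⟩, hu⟩ := hP x
    exact ⟨u, z, hz.symm, hu⟩)
  have key : ∀ T : NTree n, ∃ D, ∀ u : List (Fin n), D ≤ u.length →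
      ∃ v ∈ T.leaves, ∃ t, u = v ++ t := by
    intro T
    induction T with
    | leaf => exact ⟨0, fun u _ => ⟨[], rfl, u, rfl⟩⟩
    | caret c ih =>
      choose D hD using ih
      refine ⟨(Finset.univ.sup D) + 1, fun u hu => ?_⟩
      cases u with
      | nil => simp at hu
      | cons i u =>
        obtain ⟨v, hv, t, rfl⟩ := hD i u
          ((Finset.le_sup (Finset.mem_univ i)).trans (by simpa using hu))
        exact ⟨i :: v, ⟨i, v, hv, rfl⟩, t, rfl⟩
  obtain ⟨D, hD⟩ := key T
  refine ⟨D, fun u hu => ?_⟩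
  obtain ⟨v, hv, t, rfl⟩ := hD u hu
  exact hmono _ _ (hT v hv)

section Nontrivial

variable [Nontrivial (Fin n)]

instance : Nonempty (Cantor n) := ⟨fun _ => Classical.choice inferInstance⟩

theorem exists_ne_mem_cone (u : List (Fin n)) : ∃ x ∈ cone u, ∃ y ∈ cone u, x ≠ y := by
  obtain ⟨i, j, hij⟩ := exists_pair_ne (Fin n)
  refine ⟨_, prepend_mem_cone u fun _ => i, _, prepend_mem_cone u fun _ => j, fun h => hij ?_⟩
  exact congrFun (prepend_injective u h) 0

theorem eq_of_forall_prepend_eq {u v : List (Fin n)} (h : ∀ z, prepend u z = prepend v z) :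
    u = v := by
  wlog hle : u.length ≤ v.length generalizing u v
  · exact (this (fun z => (h z).symm) (by omega)).symm
  obtain ⟨z₀⟩ := (inferInstance : Nonempty (Cantor n))
  obtain ⟨t, rfl⟩ := exists_eq_append_of_mem_cone (prepend_mem_cone u z₀)
    (h z₀ ▸ prepend_mem_cone v z₀) hle
  cases t with
  | nil => simp
  | cons i t =>
    obtain ⟨j, hj⟩ := exists_ne i
    have := prepend_injective u ((h fun _ => j).trans (prepend_append _ _ _))
    exact absurd (congrFun this 0) hj

end Nontrivial

/-! ### Local permutations of the Cantor set -/

/-- `f` replaces the prefix `u` by `v` on the cone of `u`. -/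
def Replaces (f : Perm (Cantor n)) (u v : List (Fin n)) : Prop :=
  ∀ z, f (prepend u z) = prepend v z

namespace Replaces

variable {f g : Perm (Cantor n)} {u v w : List (Fin n)}

theorem append (h : Replaces f u v) (t : List (Fin n)) : Replaces f (u ++ t) (v ++ t) := by
  intro z
  rw [prepend_append, prepend_append, h]

theorem one (u : List (Fin n)) : Replaces 1 u u := fun _ => rfl

theorem mul (hf : Replaces f v w) (hg : Replaces g u v) : Replaces (f * g) u w := by
  intro z
  rw [Perm.mul_apply, hg, hf]

theorem inv (h : Replaces f u v) : Replaces f⁻¹ v u := by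
  intro z
  rw [Perm.inv_eq_iff_eq, h]

theorem pow (h : Replaces f u u) (k : ℕ) : Replaces (f ^ k) u u := by
  induction k with
  | zero => exact one u
  | succ k ih => rw [pow_succ]; exact ih.mul h

theorem mem_cone (h : Replaces f u v) {x : Cantor n} (hx : x ∈ cone u) : f x ∈ cone v := by
  obtain ⟨z, rfl⟩ := hx
  exact ⟨z, (h z).symm⟩

theorem unique [Nontrivial (Fin n)] (h : Replaces f u v) (h' : Replaces f u w) : v = w :=
  eq_of_forall_prepend_eq fun z => (h z).symm.trans (h' z)

theorem unique_left [Nontrivial (Fin n)] (h : Replaces f u w) (h' : Replaces f v w) : u = v :=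
  h.inv.unique h'.inv

/-- A map that replaces `u` by a longer word extending `u` contracts the cone of `u`. -/
theorem exists_pow_append {e : List (Fin n)} (h : Replaces f u (u ++ e)) (he : e ≠ []) (k : ℕ) :
    ∃ e' : List (Fin n), k ≤ e'.length ∧ Replaces (f ^ k) u (u ++ e') := by
  induction k with
  | zero => exact ⟨[], by simp, by simpa using one u⟩
  | succ k ih =>
    obtain ⟨e', he', h'⟩ := ih
    have hpos : 0 < e.length := List.length_pos_iff.2 he
    refine ⟨e' ++ e, by simp; omega, ?_⟩
    rw [pow_succ, ← List.append_assoc]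
    exact (h'.append e).mul h

theorem exists_fixed {e : List (Fin n)} (h : Replaces f u (u ++ e)) (he : e ≠ []) :
    ∃ p ∈ cone u, f p = p := by
  obtain ⟨q, hq⟩ := exists_prepend_eq_self he
  exact ⟨_, prepend_mem_cone u q, by rw [h, prepend_append, hq]⟩

/-- A contraction of a cone has at most one periodic point in this cone. -/
theorem periodic_unique {e : List (Fin n)} (h : Replaces f u (u ++ e)) (he : e ≠ [])
    {x y : Cantor n} (hx : x ∈ cone u) (hy : y ∈ cone u) {k l : ℕ} (hk : 0 < k) (hl : 0 < l)
    (hkx : (f ^ k) x = x) (hly : (f ^ l) y = y) : x = y := by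
  refine eq_of_arbitrarily_long fun m => ?_
  obtain ⟨e', he', h'⟩ := h.exists_pow_append he (k * l * m)
  have hx' : (f ^ (k * l * m)) x = x := by
    rw [mul_assoc, pow_mul]; exact Perm.pow_apply_eq_self_of_apply_eq_self hkx _
  have hy' : (f ^ (k * l * m)) y = y := by
    rw [mul_comm k l, mul_assoc, pow_mul]; exact Perm.pow_apply_eq_self_of_apply_eq_self hly _
  refine ⟨u ++ e', ?_, hx' ▸ h'.mem_cone hx, hy' ▸ h'.mem_cone hy⟩
  have : m ≤ k * l * m := Nat.le_mul_of_pos_left _ (Nat.mul_pos hk hl)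
  rw [List.length_append]; omega

end Replaces

variable (n) in
/-- The group of all permutations of the Cantor set that replace a prefix near each point. -/
def localPerm : Subgroup (Perm (Cantor n)) where
  carrier := {f | ∀ x, ∃ u v, x ∈ cone u ∧ Replaces f u v}
  one_mem' x := ⟨[], [], ⟨x, rfl⟩, .one []⟩
  mul_mem' := by
    intro f g hf hg x
    obtain ⟨u, v, hx, hu⟩ := hg x
    obtain ⟨u', v', hx', hu'⟩ := hf (g x)
    rcases le_total v.length u'.length with h | h
    · obtain ⟨t, rfl⟩ := exists_eq_append_of_mem_cone (hu.mem_cone hx) hx' h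
      refine ⟨u ++ t, v', ?_, hu'.mul (hu.append t)⟩
      simpa using (hu.append t).inv.mem_cone hx'
    · obtain ⟨t, rfl⟩ := exists_eq_append_of_mem_cone hx' (hu.mem_cone hx) h
      exact ⟨u, v' ++ t, hx, (hu'.append t).mul hu⟩
  inv_mem' := by
    intro f hf x
    obtain ⟨u, v, hx, hu⟩ := hf (f⁻¹ x)
    exact ⟨v, u, by simpa using hu.mem_cone hx, hu.inv⟩

theorem exists_cone_mapsTo {f : Perm (Cantor n)} (hf : f ∈ localPerm n) {x : Cantor n}
    {a : List (Fin n)} (hxa : f x ∈ cone a) : ∃ w, x ∈ cone w ∧ ∀ y ∈ cone w, f y ∈ cone a := by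
  obtain ⟨u, v, hxu, hu⟩ := hf x
  rcases le_total a.length v.length with h | h
  · obtain ⟨t, rfl⟩ := exists_eq_append_of_mem_cone hxa (hu.mem_cone hxu) h
    exact ⟨u, hxu, fun y hy => cone_append_subset a t (hu.mem_cone hy)⟩
  · obtain ⟨t, rfl⟩ := exists_eq_append_of_mem_cone (hu.mem_cone hxu) hxa h
    refine ⟨u ++ t, ?_, fun y hy => (hu.append t).mem_cone hy⟩
    simpa using (hu.append t).inv.mem_cone hxa

theorem exists_forall_replaces {f : Perm (Cantor n)} (hf : f ∈ localPerm n) :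
    ∃ D, ∀ u : List (Fin n), D ≤ u.length → ∃ v, Replaces f u v := by
  refine exists_length_forall _ ?_ fun x => ?_
  · rintro u t ⟨v, h⟩
    exact ⟨v ++ t, h.append t⟩
  · obtain ⟨u, v, hx, h⟩ := hf x
    exact ⟨u, hx, v, h⟩

/-! ### Dynamics of a local permutation -/

/-- Some positive power of `f` is the identity near `x`. -/
def IsTorsionAt (f : Perm (Cantor n)) (x : Cantor n) : Prop :=
  ∃ k > 0, ∃ u, x ∈ cone u ∧ Replaces (f ^ k) u u

/-- The forward orbit of `x` enters a cone that is contracted by a positive power of `f`. -/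
def IsAttracted (f : Perm (Cantor n)) (x : Cantor n) : Prop :=
  ∃ k, ∃ i > 0, ∃ a e, e ≠ [] ∧ (f ^ k) x ∈ cone a ∧ Replaces (f ^ i) a (a ++ e)

/-- `x` is a periodic point of `f`, and a positive power of `f⁻¹` contracts a cone at `x`. -/
def IsRepelling (f : Perm (Cantor n)) (x : Cantor n) : Prop :=
  ∃ i > 0, ∃ a e, e ≠ [] ∧ x ∈ cone a ∧ Replaces (f⁻¹ ^ i) a (a ++ e) ∧ (f ^ i) x = x

section Trichotomy

variable [Nontrivial (Fin n)] {f : Perm (Cantor n)} {N : ℕ}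

/-- If all forward iterates of `f` replace the prefix `u`, then either some iterate is the identity
on the cone of `u`, or the images of `u` grow. From a moment on after which no image is shorter than
the present one, only the first `N` letters matter, and such a block of letters occurs twice. -/
theorem isTorsionAt_or_isAttracted (hN : ∀ u : List (Fin n), N ≤ u.length → ∃ v, Replaces f u v)
    {u : List (Fin n)} {x : Cantor n} (hx : x ∈ cone u)
    (h : ∀ k, ∃ v, Replaces (f ^ k) u v) : IsTorsionAt f x ∨ IsAttracted f x := by
  choose v hv using h
  by_cases hinj : Function.Injective v
  swap
  · left
    obtain ⟨i, j, hij, hne⟩ : ∃ i j, v i = v j ∧ i < j := by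
      simp only [Function.Injective, not_forall] at hinj
      obtain ⟨i, j, hij, hne⟩ := hinj
      rcases lt_or_gt_of_ne hne with h | h
      · exact ⟨i, j, hij, h⟩
      · exact ⟨j, i, hij.symm, h⟩
    refine ⟨j - i, by omega, u, hx, ?_⟩
    have h1 : f ^ (j - i) = (f ^ i)⁻¹ * f ^ j := by
      rw [eq_inv_mul_iff_mul_eq, ← pow_add]; congr 1; omega
    rw [h1]
    exact (hv i).inv.mul (hij ▸ hv j)
  right
  have hlong : ∀ L, ∃ K, ∀ k ≥ K, L ≤ (v k).length := by
    intro L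
    have hfin : {k | (v k).length < L}.Finite :=
      (List.finite_length_lt (Fin n) L).preimage hinj.injOn
    obtain ⟨K, hK⟩ := hfin.bddAbove
    refine ⟨K + 1, fun k hk => ?_⟩
    by_contra hlt
    have : k ≤ K := hK (show (v k).length < L by omega)
    omega
  -- the moments after which no image is shorter than the present one
  let S : Set ℕ := {k | N ≤ (v k).length ∧ ∀ k' ≥ k, (v k).length ≤ (v k').length}
  have hS : S.Infinite := by
    refine Set.infinite_of_forall_exists_gt fun K₀ => ?_
    obtain ⟨K, hK⟩ := hlong N
    obtain ⟨m, hm, hmin⟩ := exists_minimalFor_of_wellFoundedLT (fun k => K₀ + 1 + K ≤ k)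
      (fun k => (v k).length) ⟨_, le_rfl⟩
    refine ⟨m, ⟨hK m (by omega), fun k' hk' => ?_⟩, by omega⟩
    by_contra hlt
    exact hlt (hmin (show K₀ + 1 + K ≤ k' by omega) (not_le.1 hlt).le)
  obtain ⟨k, hk, k', hk', hlt, heq⟩ := hS.exists_lt_map_eq_of_mapsTo
    (f := fun k => (v k).take N) (t := {l | l.length < N + 1})
    (fun k _ => by simp) (List.finite_length_lt (Fin n) (N + 1))
  obtain ⟨a, b, hab, ha⟩ : ∃ a b, v k = a ++ b ∧ a.length = N :=
    ⟨(v k).take N, (v k).drop N, (List.take_append_drop _ _).symm, by simpa using hk.1⟩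
  -- the part `b` is never touched afterwards
  have hstep : ∀ i, ∃ c, Replaces (f ^ i) a c ∧ v (k + i) = c ++ b := by
    intro i
    induction i with
    | zero => exact ⟨a, .one a, hab⟩
    | succ i ih =>
      obtain ⟨c, hc, hcb⟩ := ih
      have hlen : N ≤ c.length := by
        have := hk.2 (k + i) (by omega)
        rw [hcb, hab, List.length_append, List.length_append] at this
        omega
      obtain ⟨d, hd⟩ := hN c hlen
      refine ⟨d, by rw [pow_succ']; exact hd.mul hc, (hv (k + i + 1)).unique ?_⟩
      rw [pow_succ']
      exact (hd.append b).mul (hcb ▸ hv (k + i))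
  obtain ⟨c, hc, hcb⟩ := hstep (k' - k)
  rw [show k + (k' - k) = k' by omega] at hcb
  have hclen : N ≤ c.length := by
    have := hk.2 k' (by omega)
    rw [hcb, hab, List.length_append, List.length_append] at this
    omega
  have hca : c = a ++ c.drop N := by
    conv_lhs => rw [← List.take_append_drop N c]
    congr 1
    have h1 : (v k).take N = (v k').take N := heq
    rw [hab, hcb, List.take_append_of_le_length ha.ge, List.take_append_of_le_length hclen] at h1
    rw [← h1, ← ha, List.take_length]
  refine ⟨k, k' - k, by omega, a, c.drop N, fun he => ?_, ?_, hca ▸ hc⟩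
  · rw [he, List.append_nil] at hca
    have := hinj (hab.trans (hca ▸ hcb.symm))
    omega
  · exact cone_append_subset a b (hab ▸ (hv k).mem_cone hx)

/-- If no prefix of `x` is replaced by all forward iterates of `f`, then `x` is a repelling periodic
point: arbitrarily long prefixes of `x` are shortened, by suitable iterates, to one and the same
word `v`, and the backward iterates of `f` contract the cone of `v` to an orbit that contains
`x`. -/
theorem isRepelling_of_forall (hN : ∀ u : List (Fin n), N ≤ u.length → ∃ v, Replaces f u v)
    {x : Cantor n} (h : ∀ u, x ∈ cone u → ∃ k, ¬ ∃ v, Replaces (f ^ k) u v) :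
    IsRepelling f x := by
  classical
  -- just before the first iterate that does not replace the prefix, the image has length below `N`
  have hshort : ∀ D, ∃ k v, Replaces (f ^ k) (pre x (N + D)) v ∧ v.length < N := by
    intro D
    have hex := h _ (mem_cone_pre x (N + D))
    obtain ⟨j, hj⟩ : ∃ j, Nat.find hex = j + 1 := by
      refine Nat.exists_eq_succ_of_ne_zero fun h0 => ?_
      have := Nat.find_spec hex
      rw [h0] at this
      exact this ⟨_, .one _⟩
    obtain ⟨v, hv⟩ := not_not.1 (Nat.find_min hex (m := j) (by omega))
    refine ⟨j, v, hv, ?_⟩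
    by_contra hlen
    obtain ⟨w, hw⟩ := hN v (by omega)
    have := Nat.find_spec hex
    rw [hj, pow_succ'] at this
    exact this ⟨w, hw.mul hv⟩
  choose k v hkv hlen using hshort
  have : Finite {l : List (Fin n) // l.length < N} := (List.finite_length_lt (Fin n) N).to_subtype
  obtain ⟨⟨w, _⟩, hw⟩ := Finite.exists_infinite_fiber
    (fun D => (⟨v D, hlen D⟩ : {l : List (Fin n) // l.length < N}))
  have hS : {D | v D = w}.Infinite := by
    rw [← Set.infinite_coe_iff]
    refine (Equiv.setCongr ?_).infinite_iff.1 hw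
    ext D
    simp
  set S := {D | v D = w} with hSdef
  have hkw : ∀ D ∈ S, Replaces (f ^ k D) (pre x (N + D)) w := fun D hD =>
    (show v D = w from hD) ▸ hkv D
  have hinj : Set.InjOn k S := by
    intro D hD D' hD' hDD
    have h1 := hkw D hD
    rw [hDD] at h1
    have := congrArg List.length (h1.unique_left (hkw D' hD'))
    simpa using this
  obtain ⟨D₀, hD₀⟩ := hS.nonempty
  have hS' : {D ∈ S | D₀ < D ∧ k D₀ < k D}.Infinite := by
    have h1 : ({D ∈ S | k D ≤ k D₀} ∪ {D | D ≤ D₀}).Finite := by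
      refine Set.Finite.union ?_ (Set.finite_le_nat D₀)
      refine Set.Finite.of_finite_image ((Set.finite_le_nat (k D₀)).subset ?_)
        (hinj.mono fun D hD => hD.1)
      rintro _ ⟨D, hD, rfl⟩
      exact hD.2
    refine (hS.sdiff h1).mono fun D hD => ⟨hD.1, ?_⟩
    have h2 := hD.2
    simp only [Set.mem_union, Set.mem_ofPred_eq, not_or, not_and, not_le] at h2
    exact ⟨h2.2, h2.1 hD.1⟩
  have hcontract : ∀ D ∈ {D ∈ S | D₀ < D ∧ k D₀ < k D},
      Replaces (f⁻¹ ^ (k D - k D₀)) (pre x (N + D₀)) (pre x (N + D)) := by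
    rintro D ⟨hD, -, hlt⟩
    have h1 : f⁻¹ ^ (k D - k D₀) = (f ^ k D)⁻¹ * f ^ k D₀ := by
      rw [inv_pow, inv_eq_iff_eq_inv, mul_inv_rev, inv_inv, eq_inv_mul_iff_mul_eq, ← pow_add]
      congr 1; omega
    rw [h1]
    exact (hkw D hD).inv.mul (hkw D₀ hD₀)
  obtain ⟨D₁, hD₁⟩ := hS'.nonempty
  obtain ⟨e, he⟩ := exists_eq_append_of_mem_cone (mem_cone_pre x (N + D₀))
    (mem_cone_pre x (N + D₁)) (by have := hD₁.2.1; simp; omega)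
  have hne : e ≠ [] := by
    rintro rfl
    have := congrArg List.length he
    have := hD₁.2.1
    simp at *
    omega
  have hi : 0 < k D₁ - k D₀ := by have := hD₁.2.2; omega
  have hc := hcontract D₁ hD₁
  rw [he] at hc
  generalize k D₁ - k D₀ = i at hi hc
  refine ⟨i, hi, _, e, hne, mem_cone_pre x _, hc, ?_⟩
  obtain ⟨p, hp, hfp⟩ := hc.exists_fixed hne
  -- infinitely many of the contractions move `p` in the same way
  obtain ⟨j, hj⟩ : ∃ j, {D ∈ {D ∈ S | D₀ < D ∧ k D₀ < k D} | (k D - k D₀) % i = j}.Infinite := by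
    by_contra! hcon
    refine hS' (((Set.finite_lt_nat i).biUnion fun j _ => hcon j).subset fun D hD => ?_)
    simp only [Set.mem_iUnion]
    exact ⟨_, Nat.mod_lt _ hi, hD, rfl⟩
  have hjx : (f⁻¹ ^ j) p = x := by
    refine eq_of_arbitrarily_long fun m => ?_
    obtain ⟨D, hD, hmD⟩ := hj.exists_gt m
    refine ⟨pre x (N + D), by simp; omega, ?_, mem_cone_pre x _⟩
    have h1 := (hcontract D hD.1).mem_cone hp
    have h2 : (f⁻¹ ^ (k D - k D₀)) p = (f⁻¹ ^ j) p := by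
      conv_lhs => rw [← Nat.mod_add_div (k D - k D₀) i, hD.2, pow_add, Perm.mul_apply, pow_mul]
      rw [Perm.pow_apply_eq_self_of_apply_eq_self hfp]
    rwa [h2] at h1
  have h3 : (f⁻¹ ^ i) x = x := by
    rw [← hjx, ← Perm.mul_apply, ← pow_add, add_comm, pow_add, Perm.mul_apply, hfp]
  rw [inv_pow, Perm.inv_eq_iff_eq] at h3
  exact h3.symm

end Trichotomy

theorem isRepelling_or_isTorsionAt_or_isAttracted [Nontrivial (Fin n)] {f : Perm (Cantor n)}
    (hf : f ∈ localPerm n) (x : Cantor n) :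
    IsRepelling f x ∨ IsTorsionAt f x ∨ IsAttracted f x := by
  obtain ⟨N, hN⟩ := exists_forall_replaces hf
  by_cases h : ∃ u, x ∈ cone u ∧ ∀ k, ∃ v, Replaces (f ^ k) u v
  · obtain ⟨u, hx, hu⟩ := h
    exact .inr (isTorsionAt_or_isAttracted hN hx hu)
  · push Not at h
    exact .inl (isRepelling_of_forall hN fun u hu => by simpa using h u hu)

section Consequences

variable {f : Perm (Cantor n)} {x : Cantor n}

theorem inv_pow_apply_eq_self {k : ℕ} (h : (f ^ k) x = x) : (f⁻¹ ^ k) x = x := by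
  rw [inv_pow, Perm.inv_eq_iff_eq, h]

theorem IsTorsionAt.inv (h : IsTorsionAt f x) : IsTorsionAt f⁻¹ x := by
  obtain ⟨k, hk, u, hx, hu⟩ := h
  exact ⟨k, hk, u, hx, by rw [inv_pow]; exact hu.inv⟩

/-- No torsion point lies in a cone that is contracted by a power of `f`. -/
theorem IsTorsionAt.not_mem_cone [Nontrivial (Fin n)] (h : IsTorsionAt f x) {i : ℕ}
    {a e : List (Fin n)} (ha : Replaces (f ^ i) a (a ++ e)) (he : e ≠ []) : x ∉ cone a := by
  intro hxa
  obtain ⟨k, hk, u, hxu, hu⟩ := h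
  obtain ⟨w, hwa, hwu⟩ : ∃ w, cone w ⊆ cone a ∧ cone w ⊆ cone u := by
    rcases le_total a.length u.length with h | h
    · obtain ⟨t, rfl⟩ := exists_eq_append_of_mem_cone hxa hxu h
      exact ⟨_, cone_append_subset a t, subset_rfl⟩
    · obtain ⟨t, rfl⟩ := exists_eq_append_of_mem_cone hxu hxa h
      exact ⟨_, subset_rfl, cone_append_subset u t⟩
  have hper : ∀ y ∈ cone w, ((f ^ i) ^ k) y = y := by
    intro y hy
    obtain ⟨z, rfl⟩ := hwu hy
    rw [← pow_mul, mul_comm, pow_mul]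
    exact hu.pow i z
  obtain ⟨y, hy, y', hy', hne⟩ := exists_ne_mem_cone w
  exact hne (ha.periodic_unique he (hwa hy) (hwa hy') hk hk (hper y hy) (hper y' hy'))

/-- Torsion points stay torsion points under permutations that commute with `f`. -/
theorem IsTorsionAt.apply (h : IsTorsionAt f x) {g : Perm (Cantor n)} (hg : g ∈ localPerm n)
    (hgf : Commute g f) : IsTorsionAt f (g x) := by
  obtain ⟨k, hk, u, hxu, hu⟩ := h
  obtain ⟨w, v, hxw, hw⟩ := hg x
  have key : ∀ u v, Replaces g u v → Replaces (f ^ k) u u → Replaces (f ^ k) v v := by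
    intro u v hg hu z
    rw [← hg, ← Perm.mul_apply, ← (hgf.pow_right k).eq, Perm.mul_apply, hu]
  rcases le_total w.length u.length with h | h
  · obtain ⟨t, rfl⟩ := exists_eq_append_of_mem_cone hxw hxu h
    exact ⟨k, hk, v ++ t, (hw.append t).mem_cone hxu, key _ _ (hw.append t) hu⟩
  · obtain ⟨t, rfl⟩ := exists_eq_append_of_mem_cone hxu hxw h
    exact ⟨k, hk, v, hw.mem_cone hxw, key _ _ hw (hu.append t)⟩

theorem isTorsionAt_apply_iff {g : Perm (Cantor n)} (hg : g ∈ localPerm n)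
    (hgf : Commute g f) : IsTorsionAt f (g x) ↔ IsTorsionAt f x :=
  ⟨fun h => by simpa using h.apply (inv_mem hg) hgf.inv_left, fun h => h.apply hg hgf⟩

/-- A repelling point may be given by an arbitrarily long word. -/
theorem IsRepelling.exists_long (h : IsRepelling f x) (m : ℕ) :
    ∃ i > 0, ∃ a e, e ≠ [] ∧ m ≤ a.length ∧ x ∈ cone a ∧ Replaces (f⁻¹ ^ i) a (a ++ e) ∧
      (f ^ i) x = x := by
  obtain ⟨i, hi, a, e, he, hxa, ha, hx⟩ := h
  obtain ⟨e', hm, he'⟩ := ha.exists_pow_append he m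
  have hx' := inv_pow_apply_eq_self hx
  have hxm : x ∈ cone (a ++ e') := by
    have := he'.mem_cone hxa
    rwa [Perm.pow_apply_eq_self_of_apply_eq_self hx'] at this
  have hr : Replaces (f⁻¹ ^ i) (a ++ e') (a ++ e ++ e') := ha.append e'
  obtain ⟨t, ht⟩ := exists_eq_append_of_mem_cone hxm (hx' ▸ hr.mem_cone hxm) (by simp)
  refine ⟨i, hi, a ++ e', t, ?_, by simp; omega, hxm, ht ▸ hr, hx⟩
  rintro rfl
  have h1 := congrArg List.length ht
  have h2 := List.length_pos_iff.2 he
  simp only [List.length_append, List.length_nil] at h1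
  omega

theorem IsRepelling.apply (h : IsRepelling f x) {g : Perm (Cantor n)} (hg : g ∈ localPerm n)
    (hgf : Commute g f) : IsRepelling f (g x) := by
  obtain ⟨u, v, hxu, hu⟩ := hg x
  obtain ⟨i, hi, a, e, he, hm, hxa, ha, hx⟩ := h.exists_long u.length
  obtain ⟨t, rfl⟩ := exists_eq_append_of_mem_cone hxu hxa hm
  refine ⟨i, hi, v ++ t, e, he, (hu.append t).mem_cone hxa, fun z => ?_, ?_⟩
  · rw [← hu.append t, ← Perm.mul_apply, ← (hgf.inv_right.pow_right i).eq, Perm.mul_apply, ha,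
      prepend_append (u ++ t), hu.append t, prepend_append (v ++ t)]
  · rw [← Perm.mul_apply, ← (hgf.pow_right i).eq, Perm.mul_apply, hx]

variable [Nontrivial (Fin n)]

theorem IsRepelling.not_isTorsionAt (h : IsRepelling f x) : ¬ IsTorsionAt f x := by
  obtain ⟨i, hi, a, e, he, hxa, ha, hx⟩ := h
  exact fun ht => ht.inv.not_mem_cone ha he hxa

/-- The set of torsion points is closed. -/
theorem exists_cone_of_not_isTorsionAt (hf : f ∈ localPerm n) (h : ¬ IsTorsionAt f x) :
    ∃ u, x ∈ cone u ∧ ∀ y ∈ cone u, ¬ IsTorsionAt f y := by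
  rcases isRepelling_or_isTorsionAt_or_isAttracted hf x with h' | h' | h'
  · obtain ⟨i, hi, a, e, he, hxa, ha, hx⟩ := h'
    exact ⟨a, hxa, fun y hy ht => ht.inv.not_mem_cone ha he hy⟩
  · exact absurd h' h
  · obtain ⟨k, i, hi, a, e, he, hxa, ha⟩ := h'
    have hfk := pow_mem hf k
    obtain ⟨w, hxw, hw⟩ := exists_cone_mapsTo hfk hxa
    exact ⟨w, hxw, fun y hy ht =>
      (ht.apply hfk (Commute.pow_self f k)).not_mem_cone ha he (hw y hy)⟩

/-- Compactness: there are finitely many repelling periodic points, since every point has a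
neighbourhood that contains at most one of them. -/
theorem finite_isRepelling (hf : f ∈ localPerm n) : {x | IsRepelling f x}.Finite := by
  suffices h : ∃ D, ∀ u : List (Fin n), D ≤ u.length →
      {x | IsRepelling f x ∧ x ∈ cone u}.Subsingleton by
    obtain ⟨D, hD⟩ := h
    refine ((List.finite_length_eq (Fin n) D).biUnion
      (t := fun u => {x | IsRepelling f x ∧ x ∈ cone u}) ?_).subset ?_
    · exact fun u hu => (hD u (ge_of_eq hu)).finite
    · intro x hx
      simp only [Set.mem_iUnion]
      exact ⟨pre x D, length_pre x D, hx, mem_cone_pre x D⟩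
  refine exists_length_forall _ ?_ ?_
  · exact fun u t hu x hx y hy =>
      hu ⟨hx.1, cone_append_subset u t hx.2⟩ ⟨hy.1, cone_append_subset u t hy.2⟩
  · intro x
    rcases isRepelling_or_isTorsionAt_or_isAttracted hf x with h' | h' | h'
    · obtain ⟨i, hi, a, e, he, hxa, ha, hx⟩ := h'
      refine ⟨a, hxa, fun y hy y' hy' => ?_⟩
      obtain ⟨⟨j, hj, -, -, -, -, -, hfy⟩, hy⟩ := hy
      obtain ⟨⟨j', hj', -, -, -, -, -, hfy'⟩, hy'⟩ := hy'
      refine ha.periodic_unique he hy hy' hj hj' ?_ ?_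
      · rw [← pow_mul, mul_comm, pow_mul]
        exact Perm.pow_apply_eq_self_of_apply_eq_self (inv_pow_apply_eq_self hfy) _
      · rw [← pow_mul, mul_comm, pow_mul]
        exact Perm.pow_apply_eq_self_of_apply_eq_self (inv_pow_apply_eq_self hfy') _
    · obtain ⟨k, hk, u, hx, hu⟩ := h'
      refine ⟨u, hx, fun y hy y' hy' => ?_⟩
      exact absurd ⟨k, hk, u, hy.2, hu⟩ hy.1.not_isTorsionAt
    · obtain ⟨k, i, hi, a, e, he, hxa, ha⟩ := h'
      have hfk := pow_mem hf k
      obtain ⟨w, hxw, hw⟩ := exists_cone_mapsTo hfk hxa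
      have hper : ∀ y, IsRepelling f y → ∃ j > 0, ((f ^ i) ^ j) ((f ^ k) y) = (f ^ k) y := by
        rintro y ⟨j, hj, -, -, -, -, -, hfy⟩
        refine ⟨j, hj, ?_⟩
        rw [← Perm.mul_apply, ← pow_mul, ← pow_add, add_comm, pow_add, Perm.mul_apply, mul_comm,
          pow_mul, Perm.pow_apply_eq_self_of_apply_eq_self hfy]
      refine ⟨w, hxw, fun y hy y' hy' => (f ^ k).injective ?_⟩
      obtain ⟨j, hj, hjy⟩ := hper y hy.1
      obtain ⟨j', hj', hjy'⟩ := hper y' hy'.1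
      exact ha.periodic_unique he (hw y hy.2) (hw y' hy'.2) hj hj' hjy hjy'

end Consequences

/-! ### Reduction to the torsion part -/

/-- A group is finitely generated if the kernel and the range of some homomorphism are. -/
theorem fg_of_fg_ker_of_fg_range {G H : Type*} [Group G] [Group H] (φ : G →* H)
    (hk : φ.ker.FG) (hr : φ.range.FG) : Group.FG G := by
  classical
  obtain ⟨S, hS⟩ := hk
  obtain ⟨T, hT⟩ := hr
  have hlift : ∀ t : T, ∃ g, φ g = t := fun t => by
    have : (t : H) ∈ φ.range := hT ▸ Subgroup.subset_closure t.2
    exact this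
  choose l hl using hlift
  refine Group.fg_iff.2 ⟨S ∪ Set.range l, ?_, S.finite_toSet.union (Set.finite_range l)⟩
  set K := Subgroup.closure ((S : Set G) ∪ Set.range l)
  have hker : φ.ker ≤ K := hS ▸ Subgroup.closure_mono Set.subset_union_left
  have hmap : φ.range ≤ K.map φ := by
    rw [← hT, Subgroup.closure_le]
    intro t ht
    exact ⟨l ⟨t, ht⟩, Subgroup.subset_closure (Or.inr ⟨_, rfl⟩), hl _⟩
  refine eq_top_iff.2 fun g _ => ?_
  obtain ⟨k, hk, hkg⟩ := hmap ⟨g, rfl⟩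
  have h1 : k⁻¹ * g ∈ K := hker (by rw [MonoidHom.mem_ker, map_mul, map_inv, hkg, inv_mul_cancel])
  simpa using mul_mem hk h1

theorem subgroup_fg_of_finite_rank {ι : Type*} [Finite ι]
    (A : Subgroup (Multiplicative (ι → ℤ))) : A.FG := by
  have h : (Subgroup.toAddSubgroup' A).FG := by
    have := IsNoetherian.noetherian (AddSubgroup.toIntSubmodule (Subgroup.toAddSubgroup' A))
    rwa [Submodule.fg_iff_addSubgroup_fg] at this
  exact (AddSubgroup.fg_iff_mul_fg _).1 h

/-- The centralizer of `f` in the group of local permutations. -/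
def localCentralizer (f : Perm (Cantor n)) : Subgroup (Perm (Cantor n)) where
  carrier := {g | g ∈ localPerm n ∧ Commute g f}
  one_mem' := ⟨one_mem _, Commute.one_left f⟩
  mul_mem' h h' := ⟨mul_mem h.1 h'.1, h.2.mul_left h'.2⟩
  inv_mem' h := ⟨inv_mem h.1, h.2.inv_left⟩

/-- The local permutations that commute with `f` and fix each point that is not a torsion point. -/
def torsionCentralizer (f : Perm (Cantor n)) : Subgroup (Perm (Cantor n)) where
  carrier := {g | g ∈ localCentralizer f ∧ ∀ x, ¬ IsTorsionAt f x → g x = x}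
  one_mem' := ⟨one_mem _, fun _ _ => rfl⟩
  mul_mem' h h' := ⟨mul_mem h.1 h'.1, fun x hx => by rw [Perm.mul_apply, h'.2 x hx, h.2 x hx]⟩
  inv_mem' h := ⟨inv_mem h.1, fun x hx => by rw [Perm.inv_eq_iff_eq, h.2 x hx]⟩

open Classical in
/-- If `g` replaces the prefix `u` of `x` by `v`, this is `|v| - |u|`. It does not depend on the
choice of `u`. -/
noncomputable def germLength (g : Perm (Cantor n)) (x : Cantor n) : ℤ :=
  if h : ∃ u v, x ∈ cone u ∧ Replaces g u v then
    (h.choose_spec.choose.length : ℤ) - h.choose.length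
  else 0

section Nontrivial

variable [Nontrivial (Fin n)] {f g g' : Perm (Cantor n)} {x : Cantor n}

theorem germLength_eq {u v : List (Fin n)} (hx : x ∈ cone u) (h : Replaces g u v) :
    germLength g x = v.length - u.length := by
  have key : ∀ {u v u' v' : List (Fin n)}, x ∈ cone u → Replaces g u v → x ∈ cone u' →
      Replaces g u' v' → u.length ≤ u'.length →
      (v.length : ℤ) - u.length = v'.length - u'.length := by
    intro u v u' v' hu h hu' h' hle
    obtain ⟨t, rfl⟩ := exists_eq_append_of_mem_cone hu hu' hle
    obtain rfl := (h.append t).unique h'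
    simp
  have hex : ∃ u v, x ∈ cone u ∧ Replaces g u v := ⟨u, v, hx, h⟩
  rw [germLength, dif_pos hex]
  obtain ⟨h1, h2⟩ := hex.choose_spec.choose_spec
  rcases le_total u.length hex.choose.length with hle | hle
  · exact (key hx h h1 h2 hle).symm
  · exact key h1 h2 hx h hle

theorem germLength_mul (hg : g ∈ localPerm n) (hg' : g' ∈ localPerm n) :
    germLength (g * g') x = germLength g (g' x) + germLength g' x := by
  obtain ⟨w, w', hxw, hw⟩ := hg (g' x)
  obtain ⟨u, v, hx, hu⟩ := hg' x
  have hlong : ∃ u v, x ∈ cone u ∧ Replaces g' u v ∧ w.length ≤ v.length := by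
    obtain ⟨z, rfl⟩ := hx
    refine ⟨u ++ pre z w.length, v ++ pre z w.length, ?_, hu.append _, by simp⟩
    obtain ⟨y, hy⟩ := mem_cone_pre z w.length
    exact ⟨y, by rw [prepend_append, hy]⟩
  obtain ⟨u, v, hx, hu, hle⟩ := hlong
  obtain ⟨t, rfl⟩ := exists_eq_append_of_mem_cone hxw (hu.mem_cone hx) hle
  rw [germLength_eq hx ((hw.append t).mul hu), germLength_eq hx hu,
    germLength_eq (hu.mem_cone hx) (hw.append t)]
  ring

/-- A local permutation that fixes a point with trivial germ length is the identity near it. -/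
theorem exists_replaces_self (hg : g ∈ localPerm n) (hx : g x = x) (h0 : germLength g x = 0) :
    ∃ u, x ∈ cone u ∧ Replaces g u u := by
  obtain ⟨u, v, hxu, hu⟩ := hg x
  rw [germLength_eq hxu hu] at h0
  have := eq_of_mem_cone (hx ▸ hu.mem_cone hxu) hxu (by omega)
  exact ⟨u, hxu, this ▸ hu⟩

theorem cone_infinite (u : List (Fin n)) : (cone u).Infinite := by
  obtain ⟨i, j, hij⟩ := exists_pair_ne (Fin n)
  refine Set.infinite_of_injective_forall_mem
    (f := fun k => prepend u (fun m => if m = k then i else j)) ?_ fun k => prepend_mem_cone _ _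
  intro k k' hk
  by_contra hne
  have := congrFun (prepend_injective u hk) k
  simp [hne, hij] at this

/-- Backward iterates of `f` move almost all points that are not torsion points towards repelling
periodic points. So an element of the centralizer that is the identity near the repelling periodic
points is the identity outside the torsion part. -/
theorem mem_torsionCentralizer (hf : f ∈ localPerm n) (hg : g ∈ localCentralizer f)
    (h : ∀ x, IsRepelling f x → ∃ u, x ∈ cone u ∧ Replaces g u u) : g ∈ torsionCentralizer f := by
  have key : ∀ x, IsAttracted f⁻¹ x → g x = x := by
    rintro x ⟨k, i, hi, a, e, he, hxa, ha⟩
    obtain ⟨p, hp, hfp⟩ := ha.exists_fixed he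
    have hfp' : (f ^ i) p = p := by
      rw [inv_pow, Perm.inv_eq_iff_eq] at hfp
      exact hfp.symm
    obtain ⟨u, hpu, hu⟩ := h p ⟨i, hi, a, e, he, hp, ha, hfp'⟩
    obtain ⟨e', hlen, he'⟩ := ha.exists_pow_append he u.length
    have hpe : p ∈ cone (a ++ e') := by
      have := he'.mem_cone hp
      rwa [Perm.pow_apply_eq_self_of_apply_eq_self hfp] at this
    obtain ⟨t, ht⟩ := exists_eq_append_of_mem_cone hpu hpe (by rw [List.length_append]; omega)
    have hxe := cone_append_subset u t (ht ▸ he'.mem_cone hxa)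
    rw [← Perm.mul_apply, ← pow_mul, ← pow_add] at hxe
    obtain ⟨z, hz⟩ := hxe
    have h1 := hu z
    rw [hz, ← Perm.mul_apply, ((hg.2.inv_right).pow_right _).eq, Perm.mul_apply] at h1
    exact (f⁻¹ ^ (i * u.length + k)).injective h1
  refine ⟨hg, fun x hx => ?_⟩
  by_contra hne
  obtain ⟨w, hxw, hw⟩ := exists_cone_of_not_isTorsionAt hf hx
  -- all points near `x` are moved by `g`; as they are neither torsion points nor attracted under
  -- `f⁻¹`, they are repelling points of `f⁻¹`, of which there are only finitely many
  have hmove : ∃ w', x ∈ cone w' ∧ ∀ y ∈ cone w', g y ≠ y := by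
    obtain ⟨k, hk⟩ := Function.ne_iff.1 hne
    obtain ⟨w₁, hw₁, hw₁'⟩ := exists_cone_mapsTo hg.1 (mem_cone_pre (g x) (k + 1))
    have hk2 : ∀ y ∈ cone (pre x (k + 1)), y k = x k := fun y hy =>
      apply_eq_of_pre_eq (k := k + 1) (by
        conv_rhs => rw [eq_pre_of_mem_cone hy]
        rw [length_pre]) (by omega)
    have hk3 : ∀ y ∈ cone w₁, g y k = g x k := fun y hy =>
      apply_eq_of_pre_eq (k := k + 1) (by
        conv_rhs => rw [eq_pre_of_mem_cone (hw₁' y hy)]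
        rw [length_pre]) (by omega)
    rcases le_total w₁.length (k + 1) with hle | hle
    · obtain ⟨t, ht⟩ := exists_eq_append_of_mem_cone hw₁ (mem_cone_pre x (k + 1)) (by simpa)
      refine ⟨_, mem_cone_pre x (k + 1), fun y hy hgy => hk ?_⟩
      rw [← hk3 y (cone_append_subset _ t (ht ▸ hy)), hgy, hk2 y hy]
    · obtain ⟨t, ht⟩ := exists_eq_append_of_mem_cone (mem_cone_pre x (k + 1)) hw₁ (by simpa)
      refine ⟨_, hw₁, fun y hy hgy => hk ?_⟩
      rw [← hk3 y hy, hgy, hk2 y (cone_append_subset _ t (ht ▸ hy))]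
  obtain ⟨w', hxw', hw'⟩ := hmove
  have hcone : ∃ v, cone v ⊆ cone w ∧ cone v ⊆ cone w' := by
    rcases le_total w.length w'.length with hle | hle
    · obtain ⟨t, rfl⟩ := exists_eq_append_of_mem_cone hxw hxw' hle
      exact ⟨_, cone_append_subset w t, subset_rfl⟩
    · obtain ⟨t, rfl⟩ := exists_eq_append_of_mem_cone hxw' hxw hle
      exact ⟨_, subset_rfl, cone_append_subset w' t⟩
  obtain ⟨v, hvw, hvw'⟩ := hcone
  refine cone_infinite v ((finite_isRepelling (inv_mem hf)).subset fun y hy => ?_)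
  rcases isRepelling_or_isTorsionAt_or_isAttracted (inv_mem hf) y with h' | h' | h'
  · exact h'
  · exact absurd (by simpa using h'.inv) (hw y (hvw hy))
  · exact absurd (key y h') (hw' y (hvw' hy))

/-- The centralizer of `f` permutes the finitely many repelling periodic points. The subgroup that
fixes these points has a homomorphism to a free abelian group of finite rank, which records the
germs at the repelling points and whose kernel acts on the torsion part only. -/
theorem fg_localCentralizer (hf : f ∈ localPerm n) (h : (torsionCentralizer f).FG) :
    (localCentralizer f).FG := by
  have : Finite {x // IsRepelling f x} := (finite_isRepelling hf).to_subtype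
  let φ : localCentralizer f →* Perm {x // IsRepelling f x} :=
    { toFun := fun g => g.1.subtypePerm fun x =>
        ⟨fun hx => by simpa using hx.apply (inv_mem g.2.1) g.2.2.inv_left,
          fun hx => hx.apply g.2.1 g.2.2⟩
      map_one' := rfl
      map_mul' := fun _ _ => rfl }
  have hφ : ∀ g : φ.ker, ∀ x, IsRepelling f x → g.1.1 x = x := fun g x hx => by
    have h1 : φ g.1 ⟨x, hx⟩ = ⟨x, hx⟩ := by rw [MonoidHom.mem_ker.1 g.2]; rfl
    exact congrArg Subtype.val h1
  let ψ : φ.ker →* Multiplicative ({x // IsRepelling f x} → ℤ) :=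
    { toFun := fun g => Multiplicative.ofAdd fun x => germLength g.1.1 x
      map_one' := by
        refine congrArg Multiplicative.ofAdd (funext fun x => ?_)
        exact (germLength_eq ⟨(x : Cantor n), rfl⟩ (Replaces.one [])).trans (sub_self _)
      map_mul' := fun g g' => by
        refine congrArg Multiplicative.ofAdd (funext fun x => ?_)
        refine (germLength_mul g.1.2.1 g'.1.2.1).trans ?_
        rw [hφ g' x x.2]
        rfl }
  rw [← Group.fg_iff_subgroup_fg]
  refine fg_of_fg_ker_of_fg_range φ ?_ ((Group.fg_iff_subgroup_fg _).1 inferInstance)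
  rw [← Group.fg_iff_subgroup_fg]
  refine fg_of_fg_ker_of_fg_range ψ ?_ (subgroup_fg_of_finite_rank _)
  rw [← Group.fg_iff_subgroup_fg] at h ⊢
  have hφ' : ∀ g : torsionCentralizer f, (⟨g.1, g.2.1⟩ : localCentralizer f) ∈ φ.ker :=
    fun g => MonoidHom.mem_ker.2 (Equiv.ext fun x => Subtype.ext (g.2.2 x x.2.not_isTorsionAt))
  have hψ' : ∀ g : torsionCentralizer f, (⟨_, hφ' g⟩ : φ.ker) ∈ ψ.ker := by
    refine fun g => MonoidHom.mem_ker.2 (congrArg Multiplicative.ofAdd (funext fun x => ?_))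
    obtain ⟨w, hxw, hw⟩ := exists_cone_of_not_isTorsionAt hf x.2.not_isTorsionAt
    have : Replaces g.1 w w := fun z => g.2.2 _ (hw _ (prepend_mem_cone w z))
    exact (germLength_eq hxw this).trans (sub_self _)
  refine Group.fg_of_surjective (f :=
    { toFun := fun g : torsionCentralizer f => (⟨_, hψ' g⟩ : ψ.ker)
      map_one' := rfl
      map_mul' := fun _ _ => rfl }) ?_
  rintro ⟨g, hg⟩
  refine ⟨⟨g.1.1, mem_torsionCentralizer hf g.1.2 fun x hx => ?_⟩, rfl⟩
  exact exists_replaces_self g.1.2.1 (hφ g x hx)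
    (congrFun (Multiplicative.ofAdd.injective (MonoidHom.mem_ker.1 hg)) ⟨x, hx⟩)

end Nontrivial

/-! ### The equivariant local permutations of finitely many Cantor sets -/

variable {ι : Type*} {β : Type*}

/-- A node of the forest that consists of one `n`-ary tree for each element of `ι`. -/
abbrev Node (ι : Type*) (n : ℕ) : Type _ := ι × List (Fin n)

namespace Node

/-- The point of `ι × Cantor n` that lies under the node `u` and continues with `z`. -/
def point (u : Node ι n) (z : Cantor n) : ι × Cantor n := (u.1, prepend u.2 z)

/-- The set of points under a node. -/
def cone (u : Node ι n) : Set (ι × Cantor n) := Set.range u.point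

/-- The descendant of the node `u` reached by the word `t`. -/
def append (u : Node ι n) (t : List (Fin n)) : Node ι n := (u.1, u.2 ++ t)

/-- The distance from a node to the root of its tree. -/
def level (u : Node ι n) : ℕ := u.2.length

variable {u v : Node ι n} {x : ι × Cantor n}

@[simp] theorem level_append (t : List (Fin n)) : (u.append t).level = u.level + t.length :=
  List.length_append

@[simp] theorem append_nil (u : Node ι n) : u.append [] = u := by simp [append]

theorem point_append (t : List (Fin n)) (z : Cantor n) :
    (u.append t).point z = u.point (prepend t z) :=
  Prod.ext rfl (prepend_append _ _ _)

theorem point_mem_cone (u : Node ι n) (z : Cantor n) : u.point z ∈ u.cone := ⟨z, rfl⟩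

theorem point_injective (u : Node ι n) : Function.Injective u.point := fun _ _ h =>
  prepend_injective _ (congrArg Prod.snd h)

theorem cone_append_subset (u : Node ι n) (t : List (Fin n)) : (u.append t).cone ⊆ u.cone := by
  rintro _ ⟨z, rfl⟩
  exact ⟨_, (point_append t z).symm⟩

theorem mem_cone_iff : x ∈ u.cone ↔ x.1 = u.1 ∧ x.2 ∈ HigmanThompson.cone u.2 := by
  constructor
  · rintro ⟨z, rfl⟩
    exact ⟨rfl, z, rfl⟩
  · rintro ⟨h, z, hz⟩
    exact ⟨z, Prod.ext h.symm hz⟩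

theorem exists_eq_append (hu : x ∈ u.cone) (hv : x ∈ v.cone) (h : u.level ≤ v.level) :
    ∃ t, v = u.append t := by
  rw [mem_cone_iff] at hu hv
  obtain ⟨t, ht⟩ := exists_eq_append_of_mem_cone hu.2 hv.2 h
  exact ⟨t, Prod.ext (hv.1.symm.trans hu.1) ht⟩

theorem eq_of_mem_cone (hu : x ∈ u.cone) (hv : x ∈ v.cone) (h : u.level = v.level) : u = v := by
  rw [mem_cone_iff] at hu hv
  exact Prod.ext (hu.1.symm.trans hv.1) (HigmanThompson.eq_of_mem_cone hu.2 hv.2 h)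

theorem exists_mem_cone (x : ι × Cantor n) (d : ℕ) : ∃ u : Node ι n, u.level = d ∧ x ∈ u.cone :=
  ⟨(x.1, pre x.2 d), length_pre _ _, mem_cone_iff.2 ⟨rfl, mem_cone_pre _ _⟩⟩

theorem finite_level_eq [Finite ι] (d : ℕ) : {u : Node ι n | u.level = d}.Finite :=
  (Set.finite_univ.prod (List.finite_length_eq (Fin n) d)).subset fun _ hu => ⟨trivial, hu⟩

theorem finite_level_le [Finite ι] (d : ℕ) : {u : Node ι n | u.level ≤ d}.Finite :=
  (Set.finite_univ.prod (List.finite_length_le (Fin n) d)).subset fun _ hu => ⟨trivial, hu⟩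

theorem eq_of_forall_point_eq [Nontrivial (Fin n)] (h : ∀ z, u.point z = v.point z) : u = v :=
  Prod.ext (by simpa [point] using congrArg Prod.fst (h (Classical.arbitrary _)))
    (eq_of_forall_prepend_eq fun z => congrArg Prod.snd (h z))

end Node

open Node

/-- The `k`-th power of `a`, acting on the first coordinate of a point or of a node. -/
def turn (a : Perm ι) (k : ℤ) (p : ι × β) : ι × β := ((a ^ k) p.1, p.2)

section turn

variable (a : Perm ι)

@[simp] theorem turn_turn (k l : ℤ) (p : ι × β) : turn a k (turn a l p) = turn a (k + l) p := by
  simp [turn, zpow_add]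

@[simp] theorem turn_zero (p : ι × β) : turn a 0 p = p := rfl

theorem turn_injective (k : ℤ) : Function.Injective (turn a k : ι × β → ι × β) := fun p q h => by
  simpa using congrArg (turn a (-k)) h

theorem turn_eq_iff {k : ℤ} {p q : ι × β} : turn a k p = q ↔ p = turn a (-k) q := by
  rw [← (turn_injective a (-k)).eq_iff]
  simp

theorem turn_point (k : ℤ) (u : Node ι n) (z : Cantor n) :
    turn a k (u.point z) = point (turn a k u) z := rfl

theorem turn_append (k : ℤ) (u : Node ι n) (t : List (Fin n)) :
    turn a k (u.append t) = append (turn a k u) t := rfl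

@[simp] theorem level_turn (k : ℤ) (u : Node ι n) : Node.level (turn a k u) = u.level := rfl

theorem turn_mem_cone {k : ℤ} {u : Node ι n} {x : ι × Cantor n} (h : x ∈ u.cone) :
    turn a k x ∈ Node.cone (turn a k u) := by
  obtain ⟨z, rfl⟩ := h
  exact point_mem_cone _ z

end turn

/-- `g` maps the points under `u` to those under `v` in the canonical way. -/
def Acts (g : Perm (ι × Cantor n)) (u v : Node ι n) : Prop := ∀ z, g (u.point z) = v.point z

namespace Acts

variable {f g : Perm (ι × Cantor n)} {u v w : Node ι n}

theorem one (u : Node ι n) : Acts 1 u u := fun _ => rfl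

theorem mul (hf : Acts f v w) (hg : Acts g u v) : Acts (f * g) u w := fun z => by
  rw [Perm.mul_apply, hg, hf]

theorem inv (h : Acts g u v) : Acts g⁻¹ v u := fun z => by rw [Perm.inv_eq_iff_eq, h]

theorem append (h : Acts g u v) (t : List (Fin n)) : Acts g (u.append t) (v.append t) := fun z => by
  rw [point_append, point_append, h]

theorem mem_cone (h : Acts g u v) {x : ι × Cantor n} (hx : x ∈ u.cone) : g x ∈ v.cone := by
  obtain ⟨z, rfl⟩ := hx
  exact ⟨z, (h z).symm⟩

theorem unique [Nontrivial (Fin n)] (h : Acts g u v) (h' : Acts g u w) : v = w :=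
  eq_of_forall_point_eq fun z => (h z).symm.trans (h' z)

theorem unique_left [Nontrivial (Fin n)] (h : Acts g u w) (h' : Acts g v w) : u = v :=
  h.inv.unique h'.inv

end Acts

variable (n) in
/-- The group of the permutations of `ι × Cantor n` that replace a prefix near each point and
commute with the permutation `a` of `ι`. -/
def equivariantPerm (a : Perm ι) : Subgroup (Perm (ι × Cantor n)) where
  carrier := {g | (∀ x, ∃ u v : Node ι n, x ∈ u.cone ∧ Acts g u v) ∧
    ∀ k x, g (turn a k x) = turn a k (g x)}
  one_mem' := ⟨fun x => ⟨(x.1, []), _, mem_cone_iff.2 ⟨rfl, x.2, rfl⟩, .one _⟩, fun _ _ => rfl⟩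
  mul_mem' := by
    rintro f g ⟨hf, hf'⟩ ⟨hg, hg'⟩
    refine ⟨fun x => ?_, fun k x => by rw [Perm.mul_apply, Perm.mul_apply, hg', hf']⟩
    obtain ⟨u, v, hx, hu⟩ := hg x
    obtain ⟨u', v', hx', hu'⟩ := hf (g x)
    rcases le_total v.level u'.level with h | h
    · obtain ⟨t, rfl⟩ := exists_eq_append (hu.mem_cone hx) hx' h
      refine ⟨u.append t, v', ?_, hu'.mul (hu.append t)⟩
      simpa using (hu.append t).inv.mem_cone hx'
    · obtain ⟨t, rfl⟩ := exists_eq_append hx' (hu.mem_cone hx) h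
      exact ⟨u, v'.append t, hx, (hu'.append t).mul hu⟩
  inv_mem' := by
    rintro f ⟨hf, hf'⟩
    refine ⟨fun x => ?_, fun k x => by rw [Perm.inv_eq_iff_eq, hf']; simp⟩
    obtain ⟨u, v, hx, hu⟩ := hf (f⁻¹ x)
    exact ⟨v, u, by simpa using hu.mem_cone hx, hu.inv⟩

/-- Two elements of `ι` have cycles of the same length. -/
def SamePeriod (a : Perm ι) (i j : ι) : Prop := ∀ k : ℤ, (a ^ k) i = i ↔ (a ^ k) j = j

/-- Turned by a power of `a`, the node `u` either agrees with `v` or has no point in common with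
it. -/
def Separated (a : Perm ι) (u v : Node ι n) : Prop :=
  ∀ k x, x ∈ u.cone → turn a k x ∈ v.cone → turn a k u = v

/-- The elements of the group that permute the nodes in the orbits of `u` and `v` under `a`, and
fix the points that lie under none of them. -/
def orbitPerms (a : Perm ι) (u v : Node ι n) : Set (Perm (ι × Cantor n)) :=
  {g | g ∈ equivariantPerm n a ∧
    (∀ x, (∀ k, x ∉ Node.cone (turn a k u)) → (∀ k, x ∉ Node.cone (turn a k v)) → g x = x) ∧
    (∃ k, Acts g u (turn a k u) ∨ Acts g u (turn a k v)) ∧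
    ∃ k, Acts g v (turn a k u) ∨ Acts g v (turn a k v)}

variable {a : Perm ι} {g h : Perm (ι × Cantor n)} {u v u' v' : Node ι n}

theorem SamePeriod.symm {i j : ι} (h : SamePeriod a i j) : SamePeriod a j i := fun k => (h k).symm

theorem SamePeriod.trans {i j k : ι} (h : SamePeriod a i j) (h' : SamePeriod a j k) :
    SamePeriod a i k := fun l => (h l).trans (h' l)

theorem SamePeriod.apply_eq {i j : ι} (h : SamePeriod a i j) {k l : ℤ}
    (hkl : (a ^ k) i = (a ^ l) i) : (a ^ k) j = (a ^ l) j := by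
  have h1 := (h (-l + k)).1 (by
    rw [zpow_add, Perm.mul_apply, hkl, ← Perm.mul_apply, ← zpow_add]; simp)
  rw [zpow_add, Perm.mul_apply, zpow_neg, Perm.inv_eq_iff_eq] at h1
  exact h1

theorem Acts.turn (h : Acts g u v) (hg : g ∈ equivariantPerm n a) (k : ℤ) :
    Acts g (turn a k u) (turn a k v) := fun z => by
  rw [← turn_point, hg.2, h, turn_point]

theorem Acts.samePeriod [Nontrivial (Fin n)] (h : Acts g u v) (hg : g ∈ equivariantPerm n a) :
    SamePeriod a u.1 v.1 := by
  have key : ∀ {g : Perm (ι × Cantor n)} {u v : Node ι n}, Acts g u v → g ∈ equivariantPerm n a →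
      ∀ k : ℤ, (a ^ k) u.1 = u.1 → (a ^ k) v.1 = v.1 := by
    intro g u v h hg k hk
    have h1 : HigmanThompson.turn a k u = u := Prod.ext hk rfl
    have h2 := h.turn hg k
    rw [h1] at h2
    exact congrArg Prod.fst (h2.unique h)
  exact fun k => ⟨key h hg k, key h.inv (inv_mem hg) k⟩

theorem Separated.symm (h : Separated a u v) : Separated a v u := by
  intro k x hx hx'
  have := h (-k) _ hx' (by simpa using hx)
  rw [turn_eq_iff] at this
  simpa using this.symm

theorem separated_of_level_eq (h : u.level = v.level) : Separated a u v :=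
  fun _ _ hx hx' => Node.eq_of_mem_cone (turn_mem_cone a hx) hx' h

theorem Separated.map [Nontrivial (Fin n)] (h : Separated a u v) (hg : g ∈ equivariantPerm n a)
    (hu : Acts g u u') (hv : Acts g v v') : Separated a u' v' := by
  intro k x hx hx'
  have h1 := h k (g⁻¹ x) (hu.inv.mem_cone hx)
    (by rw [← (inv_mem hg).2]; exact hv.inv.mem_cone hx')
  have h2 := hu.turn hg k
  rw [h1] at h2
  exact h2.unique hv

theorem conj_mem_orbitPerms (hg : g ∈ orbitPerms a u v) (hh : h ∈ equivariantPerm n a)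
    (hu : Acts h u u') (hv : Acts h v v') : h * g * h⁻¹ ∈ orbitPerms a u' v' := by
  obtain ⟨hg, hx, ⟨k, hk⟩, l, hl⟩ := hg
  refine ⟨mul_mem (mul_mem hh hg) (inv_mem hh), fun x h1 h2 => ?_, ⟨k, ?_⟩, l, ?_⟩
  · rw [Perm.mul_apply, Perm.mul_apply, hx (h⁻¹ x) (fun k h3 => h1 k ?_) fun k h3 => h2 k ?_]
    · simp
    · simpa using (hu.turn hh k).mem_cone h3
    · simpa using (hv.turn hh k).mem_cone h3
  · exact hk.imp (fun h => ((hu.turn hh k).mul h).mul hu.inv)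
      fun h => ((hv.turn hh k).mul h).mul hu.inv
  · exact hl.imp (fun h => ((hu.turn hh l).mul h).mul hv.inv)
      fun h => ((hv.turn hh l).mul h).mul hv.inv

/-- A node disjoint from the orbits of `u` and `v` is fixed. -/
theorem acts_self_of_mem_orbitPerms (hg : g ∈ orbitPerms a u v) {w : Node ι n}
    (hu : ∀ k, ∀ x ∈ w.cone, x ∉ Node.cone (turn a k u))
    (hv : ∀ k, ∀ x ∈ w.cone, x ∉ Node.cone (turn a k v)) : Acts g w w := fun z =>
  hg.2.1 _ (fun k => hu k _ (point_mem_cone w z)) fun k => hv k _ (point_mem_cone w z)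

/-- An equivariant permutation belongs to the group if it is the identity off the orbits of `u` and
`v`, and acts on these nodes. -/
theorem mem_equivariantPerm_of_forall (heq : ∀ k x, g (turn a k x) = turn a k (g x))
    (hid : ∀ x, (∀ k, x ∉ Node.cone (turn a k u)) → (∀ k, x ∉ Node.cone (turn a k v)) → g x = x)
    (hu : ∃ w, Acts g u w) (hv : ∃ w, Acts g v w) : g ∈ equivariantPerm n a := by
  obtain ⟨u', hu⟩ := hu
  obtain ⟨v', hv⟩ := hv
  refine ⟨fun x => ?_, heq⟩
  by_cases h1 : ∃ k, x ∈ Node.cone (turn a k u)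
  · obtain ⟨k, hk⟩ := h1
    exact ⟨_, turn a k u', hk, fun z => by rw [← turn_point, heq, hu, turn_point]⟩
  by_cases h2 : ∃ k, x ∈ Node.cone (turn a k v)
  · obtain ⟨k, hk⟩ := h2
    exact ⟨_, turn a k v', hk, fun z => by rw [← turn_point, heq, hv, turn_point]⟩
  push Not at h1 h2
  obtain ⟨w, hw, hxw⟩ := exists_mem_cone x (max u.level v.level)
  refine ⟨w, w, hxw, fun z => hid _ (fun k hk => h1 k ?_) fun k hk => h2 k ?_⟩
  · obtain ⟨t, rfl⟩ := exists_eq_append hk (point_mem_cone w z) (by rw [level_turn]; omega)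
    exact Node.cone_append_subset _ t hxw
  · obtain ⟨t, rfl⟩ := exists_eq_append hk (point_mem_cone w z) (by rw [level_turn]; omega)
    exact Node.cone_append_subset _ t hxw

theorem exists_turn_mem_orbitPerms (u : Node ι n) (m : ℤ) :
    ∃ g ∈ orbitPerms a u (turn a m u), Acts g u (turn a m u) := by
  classical
  let P : ι × Cantor n → Prop := fun x => ∃ k, x ∈ Node.cone (turn a k u)
  have hP : ∀ k x, P (turn a k x) ↔ P x := by
    have : ∀ k x, P x → P (turn a k x) := by
      rintro k x ⟨l, hl⟩
      exact ⟨k + l, by simpa using turn_mem_cone a (k := k) hl⟩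
    exact fun k x => ⟨fun h => by simpa using this (-k) _ h, this k x⟩
  let F : ℤ → ι × Cantor n → ι × Cantor n := fun m x => if P x then turn a m x else x
  have hF : ∀ m x, F (-m) (F m x) = x := by
    intro m x
    by_cases hx : P x
    · simp [F, hx, hP]
    · simp [F, hx]
  let g : Perm (ι × Cantor n) := ⟨F m, F (-m), hF m, fun x => by simpa using hF (-m) x⟩
  have hPu : ∀ l z, P (point (turn a l u) z) := fun l z => ⟨l, point_mem_cone _ z⟩
  have hact : ∀ l, Acts g (turn a l u) (turn a m (turn a l u)) := fun l z =>
    if_pos (hPu l z)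
  have hid : ∀ x, (∀ k, x ∉ Node.cone (turn a k u)) →
      (∀ k, x ∉ Node.cone (turn a k (turn a m u))) → g x = x := fun x hx _ =>
    if_neg fun ⟨k, hk⟩ => hx k hk
  have h0 : Acts g u (turn a m u) := hact 0
  refine ⟨g, ⟨mem_equivariantPerm_of_forall (fun k x => ?_) hid ⟨_, h0⟩ ⟨_, hact m⟩, hid,
    ⟨m, .inl h0⟩, m, .inr (hact m)⟩, h0⟩
  change F m _ = turn a k (F m x)
  by_cases hx : P x
  · simp [F, hx, hP, add_comm]
  · simp [F, hx, hP]

theorem exists_swap_mem_orbitPerms (hper : SamePeriod a u.1 v.1)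
    (hdisj : ∀ k, ∀ x ∈ u.cone, turn a k x ∉ v.cone) :
    ∃ g ∈ orbitPerms a u v, Acts g u v ∧ Acts g v u := by
  classical
  let F : ι × Cantor n → ι × Cantor n := fun x =>
    if h : ∃ k z, x = turn a k (u.point z) then turn a h.choose (v.point h.choose_spec.choose)
    else if h : ∃ k z, x = turn a k (v.point z) then
      turn a h.choose (u.point h.choose_spec.choose)
    else x
  have hwell : ∀ {u v : Node ι n}, SamePeriod a u.1 v.1 → ∀ {k l z z'},
      turn a k (u.point z) = turn a l (u.point z') →
      turn a k (v.point z) = turn a l (v.point z') := by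
    intro u v h k l z z' heq
    obtain rfl := prepend_injective _ (congrArg Prod.snd heq)
    exact Prod.ext (h.apply_eq (congrArg Prod.fst heq)) rfl
  have hdisj' : ∀ k l z z', turn a k (u.point z) ≠ turn a l (v.point z') := by
    intro k l z z' heq
    refine hdisj (-l + k) _ (point_mem_cone u z) ?_
    rw [← turn_turn, heq, turn_turn, neg_add_cancel]
    exact point_mem_cone v z'
  have hFu : ∀ k z, F (turn a k (u.point z)) = turn a k (v.point z) := by
    intro k z
    have h : ∃ l z', turn a k (u.point z) = turn a l (u.point z') := ⟨k, z, rfl⟩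
    simp only [F]
    rw [dif_pos h]
    exact (hwell hper h.choose_spec.choose_spec).symm
  have hFv : ∀ k z, F (turn a k (v.point z)) = turn a k (u.point z) := by
    intro k z
    have h : ∃ l z', turn a k (v.point z) = turn a l (v.point z') := ⟨k, z, rfl⟩
    simp only [F]
    rw [dif_neg fun ⟨l, z', h'⟩ => hdisj' _ _ _ _ h'.symm, dif_pos h]
    exact (hwell (fun k => (hper k).symm) h.choose_spec.choose_spec).symm
  have hFid : ∀ x, (¬ ∃ k z, x = turn a k (u.point z)) → (¬ ∃ k z, x = turn a k (v.point z)) →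
      F x = x := by
    intro x h h'
    simp only [F]
    rw [dif_neg h, dif_neg h']
  have hinv : Function.Involutive F := by
    intro x
    by_cases h : ∃ k z, x = turn a k (u.point z)
    · obtain ⟨k, z, rfl⟩ := h
      rw [hFu, hFv]
    by_cases h' : ∃ k z, x = turn a k (v.point z)
    · obtain ⟨k, z, rfl⟩ := h'
      rw [hFv, hFu]
    rw [hFid x h h', hFid x h h']
  have hid : ∀ x, (∀ k, x ∉ Node.cone (turn a k u)) → (∀ k, x ∉ Node.cone (turn a k v)) →
      hinv.toPerm F x = x := fun x hx hx' =>
    hFid x (fun ⟨k, z, h⟩ => hx k ⟨z, h.symm⟩) fun ⟨k, z, h⟩ => hx' k ⟨z, h.symm⟩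
  have hu : Acts (hinv.toPerm F) u v := hFu 0
  have hv : Acts (hinv.toPerm F) v u := hFv 0
  refine ⟨hinv.toPerm F, ⟨mem_equivariantPerm_of_forall (fun k x => ?_) hid ⟨_, hu⟩ ⟨_, hv⟩, hid,
    ⟨0, .inr hu⟩, 0, .inl hv⟩, hu, hv⟩
  change F (turn a k x) = turn a k (F x)
  by_cases h : ∃ k z, x = turn a k (u.point z)
  · obtain ⟨l, z, rfl⟩ := h
    rw [hFu, turn_turn, turn_turn, hFu]
  by_cases h' : ∃ k z, x = turn a k (v.point z)
  · obtain ⟨l, z, rfl⟩ := h'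
    rw [hFv, turn_turn, turn_turn, hFv]
  rw [hFid x h h', hFid]
  · rintro ⟨l, z, h1⟩
    exact h ⟨-k + l, z, by rw [← turn_turn, ← h1]; simp⟩
  · rintro ⟨l, z, h1⟩
    exact h' ⟨-k + l, z, by rw [← turn_turn, ← h1]; simp⟩

theorem exists_mem_orbitPerms (hper : SamePeriod a u.1 v.1) (h : Separated a u v) :
    ∃ g ∈ orbitPerms a u v, Acts g u v := by
  by_cases huv : ∃ k, turn a k u = v
  · obtain ⟨k, rfl⟩ := huv
    exact exists_turn_mem_orbitPerms u k
  · obtain ⟨g, hg, hu, -⟩ := exists_swap_mem_orbitPerms hper fun k x hx hx' =>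
      huv ⟨k, h k x hx hx'⟩
    exact ⟨g, hg, hu⟩

/-! ### A finite generating set -/

variable (n) in
/-- The elements of the group that act on the nodes of level `3`, with images of level at most
`6`. The bounds are chosen so that this finite set contains all permutations of the orbits of two
nodes of level at most `3`. -/
def boundedElements (a : Perm ι) : Set (Perm (ι × Cantor n)) :=
  {g | g ∈ equivariantPerm n a ∧
    ∀ u : Node ι n, u.level = 3 → ∃ v : Node ι n, v.level ≤ 6 ∧ Acts g u v}

theorem finite_boundedElements [Finite ι] (a : Perm ι) : (boundedElements n a).Finite := by
  have := (finite_level_eq (ι := ι) (n := n) 3).to_subtype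
  have := (finite_level_le (ι := ι) (n := n) 6).to_subtype
  let φ (c : {u : Node ι n | u.level = 3} → {u : Node ι n | u.level ≤ 6}) :
      Set (Perm (ι × Cantor n)) := {g | ∀ u, Acts g u.1 (c u).1}
  have hφ : ∀ c, (φ c).Subsingleton := by
    intro c g hg g' hg'
    refine Equiv.ext fun x => ?_
    obtain ⟨u, hu, z, rfl⟩ := exists_mem_cone x 3
    rw [hg ⟨u, hu⟩ z, hg' ⟨u, hu⟩ z]
  refine (Set.finite_iUnion fun c => (hφ c).finite).subset fun g hg => ?_
  have h := fun u : {u : Node ι n | u.level = 3} => hg.2 u.1 u.2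
  choose c hc hgc using h
  exact Set.mem_iUnion.2 ⟨fun u => ⟨c u, hc u⟩, hgc⟩

variable (n) in
/-- The subgroup generated by the elements of bounded size. -/
def boundedClosure (a : Perm ι) : Subgroup (Perm (ι × Cantor n)) :=
  Subgroup.closure (boundedElements n a)

theorem boundedClosure_le (a : Perm ι) : boundedClosure n a ≤ equivariantPerm n a :=
  (Subgroup.closure_le _).2 fun _ hg => hg.1

theorem orbitPerms_subset_of_level_le (hu : u.level ≤ 3) (hv : v.level ≤ 3) :
    orbitPerms a u v ⊆ boundedClosure n a := by
  intro g hg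
  refine Subgroup.subset_closure ⟨hg.1, fun w hw => ?_⟩
  have key : ∀ {s s' : Node ι n}, s.level ≤ 3 → s'.level ≤ 3 → Acts g s s' → ∀ k,
      (∃ x ∈ w.cone, x ∈ Node.cone (turn a k s)) → ∃ v : Node ι n, v.level ≤ 6 ∧ Acts g w v := by
    rintro s s' hs hs' hact k ⟨x, hxw, hxs⟩
    obtain ⟨t, rfl⟩ := exists_eq_append hxs hxw (by rw [level_turn]; omega)
    refine ⟨_, ?_, (hact.turn hg.1 k).append t⟩
    simp only [level_append, level_turn] at hw ⊢
    omega
  by_cases h1 : ∃ k, ∃ x ∈ w.cone, x ∈ Node.cone (turn a k u)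
  · obtain ⟨k, hk⟩ := h1
    obtain ⟨l, hl | hl⟩ := hg.2.2.1
    · exact key hu (by simpa using hu) hl k hk
    · exact key hu (by simpa using hv) hl k hk
  by_cases h2 : ∃ k, ∃ x ∈ w.cone, x ∈ Node.cone (turn a k v)
  · obtain ⟨k, hk⟩ := h2
    obtain ⟨l, hl | hl⟩ := hg.2.2.2
    · exact key hv (by simpa using hu) hl k hk
    · exact key hv (by simpa using hv) hl k hk
  push Not at h1 h2
  exact ⟨w, by omega, acts_self_of_mem_orbitPerms hg h1 h2⟩

section Nontrivial

variable [Nontrivial (Fin n)]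

/-- A node of level at least `3` is shortened by a swap of the node of level `3` above it with some
node of level `2`. The latter can be chosen disjoint from the second node `v`, unless `v`
lies below the former and is shortened along with `u`. -/
theorem exists_shorten (hsep : Separated a u v) (hu : 3 ≤ u.level) :
    ∃ s ∈ boundedClosure n a, ∃ u' v' : Node ι n, Acts s u u' ∧ Acts s v v' ∧
      u'.level < u.level ∧ v'.level ≤ v.level := by
  obtain ⟨b, w⟩ := u
  obtain ⟨p₁, p₂, p₃, t, rfl⟩ : ∃ p₁ p₂ p₃ t, w = p₁ :: p₂ :: p₃ :: t := by
    match w, hu with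
    | p₁ :: p₂ :: p₃ :: t, _ => exact ⟨p₁, p₂, p₃, t, rfl⟩
    | [], h => simp [level] at h
    | [_], h => simp [level] at h
    | [_, _], h => simp [level] at h
  set P : Node ι n := (b, [p₁, p₂, p₃]) with hP
  have huP : ((b, p₁ :: p₂ :: p₃ :: t) : Node ι n) = P.append t := rfl
  obtain ⟨q₁, q₂, hpq, hvq⟩ : ∃ q₁ q₂, (q₁ = p₁ → q₂ ≠ p₂) ∧ v.2.head? ≠ some q₁ := by
    by_cases hv : v.2.head? = some p₁
    · obtain ⟨j, hj⟩ := exists_ne p₁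
      exact ⟨j, j, fun h => absurd h hj, fun h => hj (Option.some.inj (h.symm.trans hv))⟩
    · obtain ⟨j, hj⟩ := exists_ne p₂
      exact ⟨p₁, j, fun _ => hj, hv⟩
  set Q : Node ι n := (b, [q₁, q₂]) with hQ
  have hPQ : ∀ k, ∀ x ∈ P.cone, turn a k x ∉ Q.cone := by
    rintro k _ ⟨z, rfl⟩ ⟨z', hz'⟩
    have h1 := congrArg Prod.snd hz'
    exact hpq (congrFun h1 0) (congrFun h1 1)
  obtain ⟨s, hs, hsP, -⟩ := exists_swap_mem_orbitPerms (a := a) (u := P) (v := Q)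
    (fun _ => Iff.rfl) hPQ
  refine ⟨s, orbitPerms_subset_of_level_le (by simp [hP, level]) (by simp [hQ, level]) hs, ?_⟩
  rw [huP] at hsep ⊢
  -- the node `v` lies neither above `P` nor at the root of the same tree, since otherwise it would
  -- lie properly above `u`, up to a power of `a`
  have habove : ∀ k, ∀ x ∈ (P.append t).cone, v.level < 3 → turn a k x ∉ v.cone := by
    intro k x hx hlt hxv
    have := congrArg level (hsep k x hx hxv)
    rw [level_turn, level_append] at this
    simp only [hP, level, List.length_cons, List.length_nil] at this hlt
    omega
  by_cases hcase : ∃ k t', v = Node.append (turn a k P) t'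
  · obtain ⟨k, t', rfl⟩ := hcase
    refine ⟨_, _, hsP.append t, (hsP.turn hs.1 k).append t', ?_, ?_⟩ <;>
      simp [hP, hQ, level, Node.append, turn]
  · refine ⟨_, v, hsP.append t, acts_self_of_mem_orbitPerms hs ?_ ?_, ?_, le_rfl⟩
    · intro k x hxv hxP
      rcases le_or_gt 3 v.level with hlt | hlt
      · obtain ⟨t', ht'⟩ := exists_eq_append hxP hxv hlt
        exact hcase ⟨k, t', ht'⟩
      · obtain ⟨t', ht'⟩ := exists_eq_append hxv hxP (by
          rw [level_turn]
          simp only [hP, level, List.length_cons, List.length_nil] at hlt ⊢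
          omega)
        obtain ⟨z⟩ := (inferInstance : Nonempty (Cantor n))
        refine habove k _ (point_mem_cone _ z) hlt ?_
        have := turn_mem_cone a (k := k)
          (Node.cone_append_subset _ t (point_mem_cone (P.append t) z))
        rw [ht'] at this
        exact Node.cone_append_subset _ t' this
    · rintro k x hxv hxQ
      rw [mem_cone_iff] at hxv hxQ
      obtain ⟨hv1, y, hy⟩ := hxv
      obtain ⟨hQ1, y', hy'⟩ := hxQ
      cases hv2 : v.2 with
      | nil =>
        obtain ⟨z⟩ := (inferInstance : Nonempty (Cantor n))
        refine habove k _ (point_mem_cone _ z) (by simp [level, hv2]) (mem_cone_iff.2 ⟨?_, ?_⟩)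
        · exact hQ1.symm.trans hv1
        · rw [hv2]; exact ⟨_, rfl⟩
      | cons j w =>
        rw [hv2] at hy hvq
        have h1 := congrFun (hy.trans hy'.symm) 0
        exact hvq (congrArg some h1)
    · simp [hP, hQ, level, Node.append]

/-- All permutations of two orbits of nodes are generated by those of bounded size, since two nodes
can be shortened simultaneously. -/
theorem orbitPerms_subset (hsep : Separated a u v) : orbitPerms a u v ⊆ boundedClosure n a := by
  obtain ⟨m, hm⟩ : ∃ m, u.level + v.level = m := ⟨_, rfl⟩
  induction m using Nat.strong_induction_on generalizing u v with
  | _ m ih =>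
  have hconj : ∀ {u v u' v' : Node ι n} {s : Perm (ι × Cantor n)}, s ∈ boundedClosure n a →
      Acts s u u' → Acts s v v' → orbitPerms a u' v' ⊆ boundedClosure n a →
      orbitPerms a u v ⊆ boundedClosure n a := by
    intro u v u' v' s hs hu hv hsub g hg
    have h1 := hsub (conj_mem_orbitPerms hg (boundedClosure_le a hs) hu hv)
    have h2 := mul_mem (mul_mem (inv_mem hs) h1) hs
    simpa [mul_assoc] using h2
  by_cases hu : 3 ≤ u.level
  · obtain ⟨s, hs, u', v', hsu, hsv, hlt, hle⟩ := exists_shorten hsep hu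
    exact hconj hs hsu hsv
      (ih _ (by omega) (hsep.map (boundedClosure_le a hs) hsu hsv) rfl)
  by_cases hv : 3 ≤ v.level
  · obtain ⟨s, hs, v', u', hsv, hsu, hlt, hle⟩ := exists_shorten hsep.symm hv
    exact hconj hs hsu hsv
      (ih _ (by omega) (hsep.map (boundedClosure_le a hs) hsu hsv) rfl)
  exact orbitPerms_subset_of_level_le (by omega) (by omega)

end Nontrivial

/-! ### Every element is generated by elements of bounded size -/

theorem exists_forall_acts [Finite ι] (hg : g ∈ equivariantPerm n a) :
    ∃ d, ∀ u : Node ι n, d ≤ u.level → ∃ v, Acts g u v := by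
  have h : ∀ i : ι, ∃ D, ∀ w : List (Fin n), D ≤ w.length → ∃ v, Acts g (i, w) v := by
    intro i
    refine exists_length_forall (fun w => ∃ v, Acts g (i, w) v) ?_ fun x => ?_
    · rintro w t ⟨v, hv⟩
      exact ⟨_, hv.append t⟩
    · obtain ⟨u, v, hx, hu⟩ := hg.1 (i, x)
      rw [mem_cone_iff] at hx
      refine ⟨u.2, hx.2, v, ?_⟩
      rwa [show i = u.1 from hx.1]
  choose D hD using h
  cases nonempty_fintype ι
  exact ⟨Finset.univ.sup D, fun u hu => hD u.1 u.2 ((Finset.le_sup (Finset.mem_univ u.1)).trans hu)⟩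

section Cells

variable {d : ℕ} {q : Node ι n → Node ι n}

theorem exists_mem_cone_image (hq : ∀ u, u.level = d → Acts g u (q u)) (x : ι × Cantor n) :
    ∃ u, u.level = d ∧ x ∈ (q u).cone := by
  obtain ⟨u, hu, hx⟩ := exists_mem_cone (g⁻¹ x) d
  exact ⟨u, hu, by simpa using (hq u hu).mem_cone hx⟩

theorem eq_of_mem_cone_image (hq : ∀ u, u.level = d → Acts g u (q u)) {x : ι × Cantor n}
    (hu : u.level = d) (hv : v.level = d) (hxu : x ∈ (q u).cone) (hxv : x ∈ (q v).cone) : u = v :=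
  Node.eq_of_mem_cone ((hq u hu).inv.mem_cone hxu) ((hq v hv).inv.mem_cone hxv) (hu.trans hv.symm)

variable [Nontrivial (Fin n)]

theorem image_turn (hg : g ∈ equivariantPerm n a) (hq : ∀ u, u.level = d → Acts g u (q u))
    (hu : u.level = d) (k : ℤ) : q (turn a k u) = turn a k (q u) :=
  (hq (turn a k u) hu).unique ((hq u hu).turn hg k)

theorem exists_ne_mem_cone_of_append {t : List (Fin n)} (ht : t ≠ []) :
    ∃ x ∈ u.cone, x ∉ (u.append t).cone := by
  cases t with
  | nil => exact absurd rfl ht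
  | cons i t =>
    obtain ⟨j, hj⟩ := exists_ne i
    refine ⟨_, point_mem_cone u fun _ => j, ?_⟩
    rintro ⟨z, hz⟩
    rw [point_append] at hz
    exact hj (congrFun (u.point_injective hz) 0).symm

/-- The images of the nodes of level `d` cannot get deeper without some of them, in trees of the
same period, getting less deep: otherwise truncation to level `d` maps the images onto the nodes of
level `d`, and so bijectively, but the truncation of a deeper image is not covered. -/
theorem exists_level_lt [Finite ι] (hg : g ∈ equivariantPerm n a)
    (hq : ∀ u, u.level = d → Acts g u (q u)) (hu : u.level = d) (hlt : d < (q u).level) :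
    ∃ v, v.level = d ∧ SamePeriod a (q u).1 (q v).1 ∧ (q v).level < d := by
  by_contra! hcon
  let W := {w : Node ι n // w.level = d ∧ SamePeriod a u.1 w.1}
  have : Finite W := ((finite_level_eq d).subset fun w hw => hw.1 :
    {w : Node ι n | w.level = d ∧ SamePeriod a u.1 w.1}.Finite).to_subtype
  have hper := (hq u hu).samePeriod hg
  have hlevel : ∀ w : W, d ≤ (q w.1).level := fun w =>
    hcon w.1 w.2.1 (hper.symm.trans (w.2.2.trans ((hq _ w.2.1).samePeriod hg)))
  let τ : W → W := fun w => ⟨((q w.1).1, (q w.1).2.take d), by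
    simpa [level] using hlevel w, w.2.2.trans ((hq _ w.2.1).samePeriod hg)⟩
  have hτ : ∀ w : W, ∃ t, q w.1 = (τ w).1.append t := fun w =>
    ⟨(q w.1).2.drop d, Prod.ext rfl (List.take_append_drop d _).symm⟩
  have hcover : ∀ w : W, ∀ x ∈ w.1.cone, ∃ w' : W, x ∈ (q w'.1).cone ∧ τ w' = w := by
    intro w x hx
    obtain ⟨s, hs, hxs⟩ := exists_mem_cone_image hq x
    have h1 : (q s).1 = w.1.1 := (mem_cone_iff.1 hxs).1.symm.trans (mem_cone_iff.1 hx).1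
    have h2 := ((hq s hs).samePeriod hg).symm
    rw [h1] at h2
    refine ⟨⟨s, hs, w.2.2.trans h2⟩, hxs, ?_⟩
    obtain ⟨t, ht⟩ := hτ ⟨s, hs, w.2.2.trans h2⟩
    simp only at ht
    rw [ht] at hxs
    exact Subtype.ext (Node.eq_of_mem_cone (Node.cone_append_subset _ t hxs) hx
      ((τ _).2.1.trans w.2.1.symm))
  have hinj : Function.Injective τ := by
    refine Finite.injective_iff_surjective.2 fun w => ?_
    obtain ⟨z⟩ := (inferInstance : Nonempty (Cantor n))
    obtain ⟨w', -, h⟩ := hcover w _ (point_mem_cone w.1 z)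
    exact ⟨w', h⟩
  let w₀ : W := ⟨u, hu, fun _ => Iff.rfl⟩
  obtain ⟨t, ht⟩ := hτ w₀
  have hne : t ≠ [] := by
    rintro rfl
    have h1 := congrArg level ht
    rw [append_nil, (τ w₀).2.1] at h1
    simp only [w₀] at h1
    omega
  obtain ⟨x, hx, hx'⟩ := exists_ne_mem_cone_of_append (u := (τ w₀).1) hne
  obtain ⟨w', hw', hτ'⟩ := hcover _ x hx
  rw [hinj hτ', ht] at hw'
  exact hx' hw'

/-- The case where `g` permutes the nodes of level `d`. A node that is not fixed is brought back by
a permutation of two orbits, which contain no node that is fixed by `g`. -/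
theorem mem_boundedClosure_of_level_eq [Finite ι] (hg : g ∈ equivariantPerm n a)
    (hq : ∀ u, u.level = d → Acts g u (q u)) (hd : ∀ u, u.level = d → (q u).level = d) :
    g ∈ boundedClosure n a := by
  obtain ⟨m, hm⟩ : ∃ m, {u : Node ι n | u.level = d ∧ q u ≠ u}.ncard = m := ⟨_, rfl⟩
  induction m using Nat.strong_induction_on generalizing g q with
  | _ m ih =>
  by_cases hfix : ∀ u : Node ι n, u.level = d → q u = u
  · have : g = 1 := by
      refine Equiv.ext fun x => ?_
      obtain ⟨u, hu, z, rfl⟩ := exists_mem_cone x d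
      rw [hq u hu z, hfix u hu]
      rfl
    exact this ▸ one_mem _
  push Not at hfix
  obtain ⟨u, hu, hne⟩ := hfix
  have hsep : Separated a (q u) u := separated_of_level_eq ((hd u hu).trans hu.symm)
  obtain ⟨h, hh, hact⟩ := exists_mem_orbitPerms ((hq u hu).samePeriod hg).symm hsep
  have hhH := orbitPerms_subset hsep hh
  have key : ∀ w : Node ι n, w.level = d → ∃ w' : Node ι n, w'.level = d ∧ Acts (h * g) w w' ∧
      (q w = w → w' = w) ∧ (w = u → w' = u) := by
    intro w hw
    by_cases h1 : ∃ k, turn a k u = w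
    · obtain ⟨k, rfl⟩ := h1
      refine ⟨turn a k u, hw, ?_, fun _ => rfl, fun h => h⟩
      have := hq _ hw
      rw [image_turn hg hq hu] at this
      exact (hact.turn hh.1 k).mul this
    by_cases h2 : ∃ k, turn a k u = q w
    · obtain ⟨k, hk⟩ := h2
      have h3 := hk ▸ hq w hw
      obtain ⟨s, hs, hus⟩ : ∃ s : Node ι n, s.level = d ∧ Acts h u s := by
        obtain ⟨l, hl | hl⟩ := hh.2.2.2
        · exact ⟨turn a l (q u), hd u hu, hl⟩
        · exact ⟨turn a l u, hu, hl⟩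
      exact ⟨turn a k s, hs, (hus.turn hh.1 k).mul h3, fun h4 => absurd ⟨k, hk.trans h4⟩ h1,
        fun h4 => absurd ⟨0, h4.symm⟩ h1⟩
    by_cases h5 : ∃ k, turn a k (q u) = q w
    · obtain ⟨k, hk⟩ := h5
      refine absurd ⟨k, ?_⟩ h1
      rw [← image_turn hg hq hu] at hk
      exact (hq _ (show Node.level (turn a k u) = d from hu)).unique_left (hk ▸ hq w hw)
    · refine ⟨q w, hd w hw, (acts_self_of_mem_orbitPerms hh ?_ ?_).mul (hq w hw), fun h => h,
        fun h4 => absurd ⟨0, h4.symm⟩ h1⟩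
      · exact fun k x hx hx' => h5 ⟨k, Node.eq_of_mem_cone hx' hx ((hd u hu).trans (hd w hw).symm)⟩
      · exact fun k x hx hx' => h2 ⟨k, Node.eq_of_mem_cone hx' hx (hu.trans (hd w hw).symm)⟩
  choose! q' hq'd hq' hfix' hu' using key
  have hlt : {w : Node ι n | w.level = d ∧ q' w ≠ w}.ncard < m := by
    rw [← hm]
    refine Set.ncard_lt_ncard ⟨fun w hw => ⟨hw.1, fun h => hw.2 (hfix' w hw.1 h)⟩, fun hsub => ?_⟩
      ((finite_level_eq d).subset fun w hw => hw.1)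
    exact (hsub ⟨hu, hne⟩).2 (hu' u hu rfl)
  have := mul_mem (inv_mem hhH) (ih _ hlt (mul_mem hh.1 hg) hq' hq'd rfl)
  simpa using this

/-- If no image of a node of level `d` is deeper than `d`, then all have level `d`: apply
`exists_level_lt` to the inverse. -/
theorem level_image_eq [Finite ι] (hg : g ∈ equivariantPerm n a)
    (hq : ∀ u, u.level = d → Acts g u (q u)) (hd : ∀ u, u.level = d → (q u).level ≤ d)
    (hu : u.level = d) : (q u).level = d := by
  by_contra hne
  have key : ∀ w : Node ι n, w.level = d → ∃ w', Acts g⁻¹ w w' ∧ d ≤ w'.level ∧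
      ((∃ t, w = (q u).append t) → d < w'.level) := by
    intro w hw
    obtain ⟨z⟩ := (inferInstance : Nonempty (Cantor n))
    obtain ⟨s, hs, hxs⟩ := exists_mem_cone_image hq (w.point z)
    obtain ⟨t, rfl⟩ := exists_eq_append hxs (point_mem_cone w z) (hw ▸ hd s hs)
    refine ⟨s.append t, (hq s hs).inv.append t, by rw [level_append]; omega, ?_⟩
    rintro ⟨t', ht'⟩
    obtain ⟨x, h1⟩ : ∃ x, x ∈ ((q s).append t).cone := ⟨_, point_mem_cone _ z⟩
    have h2 := h1
    rw [ht'] at h2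
    obtain rfl := eq_of_mem_cone_image hq hs hu (Node.cone_append_subset _ _ h1)
      (Node.cone_append_subset _ _ h2)
    have := hd s hs
    rw [level_append] at hw ⊢
    omega
  choose! q' hq' hle hlt using key
  obtain ⟨i⟩ := (inferInstance : Nonempty (Fin n))
  have hw : ((q u).append (List.replicate (d - (q u).level) i)).level = d := by
    have := hd u hu
    simp; omega
  obtain ⟨v, hv, -, hv'⟩ := exists_level_lt (inv_mem hg) hq' hw (hlt _ hw ⟨_, rfl⟩)
  have := hle v hv
  omega

/-- The deepest images come in families of siblings `v.append [i]`. A swap of their parent `v` with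
an image of level less than `d` makes all of these siblings less deep. -/
theorem mem_boundedClosure_of_level_le [Finite ι] {L : ℕ} (hg : g ∈ equivariantPerm n a)
    (hq : ∀ u, u.level = d → Acts g u (q u)) (hL : ∀ u, u.level = d → (q u).level ≤ L) :
    g ∈ boundedClosure n a := by
  induction L generalizing g q with
  | zero =>
    have hd : ∀ u, u.level = d → (q u).level ≤ d := fun u hu => (hL u hu).trans (Nat.zero_le d)
    exact mem_boundedClosure_of_level_eq hg hq fun u hu => level_image_eq hg hq hd hu
  | succ L ihL =>
  obtain ⟨m, hm⟩ : ∃ m, {u : Node ι n | u.level = d ∧ (q u).level = L + 1}.ncard = m := ⟨_, rfl⟩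
  induction m using Nat.strong_induction_on generalizing g q with
  | _ m ih =>
  by_cases hall : ∀ u, u.level = d → (q u).level ≤ L
  · exact ihL hg hq hall
  by_cases hd : ∀ u, u.level = d → (q u).level ≤ d
  · exact mem_boundedClosure_of_level_eq hg hq fun u hu => level_image_eq hg hq hd hu
  push Not at hall hd
  obtain ⟨u₀, hu₀, hlt₀⟩ := hall
  have hL₀ : (q u₀).level = L + 1 := le_antisymm (hL u₀ hu₀) hlt₀
  have hdL : d ≤ L := by
    obtain ⟨u, hu, h1⟩ := hd
    have := hL u hu
    omega
  obtain ⟨c, hc, hper, hcd⟩ := exists_level_lt hg hq hu₀ (by omega)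
  obtain ⟨v, i₀, hv⟩ : ∃ v i₀, q u₀ = Node.append v [i₀] := by
    have hne : (q u₀).2 ≠ [] := by
      intro h
      rw [level, h] at hL₀
      simp at hL₀
    exact ⟨((q u₀).1, (q u₀).2.dropLast), (q u₀).2.getLast hne,
      Prod.ext rfl (List.dropLast_append_getLast hne).symm⟩
  have hvL : v.level = L := by
    rw [hv, level_append] at hL₀
    simpa using hL₀
  -- an image below `v` is one of the siblings
  have hsib : ∀ w, w.level = d → ∀ k x, x ∈ Node.cone (turn a k v) → x ∈ (q w).cone →
      ∃ i, q w = turn a k (v.append [i]) := by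
    intro w hw k x hxv hxw
    rcases le_or_gt (q w).level L with hle | hgt
    · exfalso
      obtain ⟨t, ht⟩ := exists_eq_append hxw hxv (by rw [level_turn]; omega)
      obtain ⟨z⟩ := (inferInstance : Nonempty (Cantor n))
      obtain ⟨y, h1⟩ : ∃ y, y ∈ Node.cone (turn a k (q u₀)) := ⟨_, point_mem_cone _ z⟩
      have h2 := h1
      rw [← image_turn hg hq hu₀] at h1
      rw [hv, turn_append] at h2
      have h3 := Node.cone_append_subset _ _ h2
      rw [ht] at h3
      have h4 := eq_of_mem_cone_image hq hw (show Node.level (turn a k u₀) = d from hu₀)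
        (Node.cone_append_subset _ _ h3) h1
      rw [h4, image_turn hg hq hu₀, level_turn] at hle
      omega
    · have h1 := hL w hw
      obtain ⟨t, ht⟩ := exists_eq_append hxv hxw (by rw [level_turn]; omega)
      have h2 := congrArg level ht
      rw [level_append, level_turn] at h2
      obtain ⟨i, rfl⟩ := List.length_eq_one_iff.1 (show t.length = 1 by omega)
      exact ⟨i, ht⟩
  have hdisj : ∀ k, ∀ x ∈ v.cone, turn a k x ∉ (q c).cone := by
    intro k x hx hx'
    obtain ⟨i, hi⟩ := hsib c hc k _ (turn_mem_cone a hx) hx'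
    rw [hi, level_turn, level_append] at hcd
    simp at hcd
    omega
  have hper' : SamePeriod a v.1 (q c).1 := by rwa [hv] at hper
  obtain ⟨h, hh, hvc, hcv⟩ := exists_swap_mem_orbitPerms hper' hdisj
  have hhH := orbitPerms_subset (fun k x hx hx' => absurd hx' (hdisj k x hx)) hh
  have key : ∀ w : Node ι n, w.level = d → ∃ w' : Node ι n, Acts (h * g) w w' ∧
      w'.level ≤ L + 1 ∧ (w'.level = L + 1 → (q w).level = L + 1 ∧ w ≠ u₀) := by
    intro w hw
    by_cases h1 : ∃ k, q w = turn a k (q c)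
    · obtain ⟨k, hk⟩ := h1
      refine ⟨turn a k v, (hcv.turn hh.1 k).mul (hk ▸ hq w hw), ?_, ?_⟩
      · rw [level_turn]; omega
      · rw [level_turn]; omega
    by_cases h2 : ∃ k i, q w = turn a k (v.append [i])
    · obtain ⟨k, i, hk⟩ := h2
      refine ⟨turn a k ((q c).append [i]), ((hvc.append [i]).turn hh.1 k).mul (hk ▸ hq w hw),
        ?_, ?_⟩
      · rw [level_turn, level_append, List.length_singleton]; omega
      · rw [level_turn, level_append, List.length_singleton]; omega
    refine ⟨q w, (acts_self_of_mem_orbitPerms hh ?_ ?_).mul (hq w hw), hL w hw, fun h3 => ⟨h3, ?_⟩⟩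
    · exact fun k x hx hx' => h2 ⟨k, hsib w hw k x hx' hx⟩
    · intro k x hx hx'
      rw [← image_turn hg hq hc] at hx'
      obtain rfl := eq_of_mem_cone_image hq hw (show Node.level (turn a k c) = d from hc) hx hx'
      exact h1 ⟨k, image_turn hg hq hc k⟩
    · rintro rfl
      exact h2 ⟨0, i₀, hv⟩
  choose! q' hq' hle' hlt' using key
  have hlt : {w : Node ι n | w.level = d ∧ (q' w).level = L + 1}.ncard < m := by
    rw [← hm]
    refine Set.ncard_lt_ncard ⟨fun w hw => ⟨hw.1, (hlt' w hw.1 hw.2).1⟩, fun hsub => ?_⟩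
      ((finite_level_eq d).subset fun w hw => hw.1)
    have h1 := hsub ⟨hu₀, hL₀⟩
    exact (hlt' u₀ h1.1 h1.2).2 rfl
  have := mul_mem (inv_mem hhH) (ih _ hlt (mul_mem hh.1 hg) hq' hle' rfl)
  simpa using this

end Cells

theorem fg_equivariantPerm [Nontrivial (Fin n)] [Finite ι] (a : Perm ι) :
    (equivariantPerm n a).FG := by
  refine (Subgroup.fg_iff _).2 ⟨boundedElements n a, le_antisymm (boundedClosure_le a) ?_,
    finite_boundedElements a⟩
  intro g hg
  obtain ⟨d, hd⟩ := exists_forall_acts hg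
  choose! q hq using hd
  have hfin : (level '' (q '' {u : Node ι n | u.level = d})).Finite :=
    ((finite_level_eq d).image q).image level
  obtain ⟨L, hL⟩ := hfin.bddAbove
  exact mem_boundedClosure_of_level_le hg (d := d) (q := q) (L := L) (fun u hu => hq u hu.ge)
    fun u hu => hL ⟨_, ⟨u, hu, rfl⟩, rfl⟩

/-! ### The torsion part -/

/-- The word `u` is good for `f` if all iterates of `f` replace the prefix `u`, and some positive
iterate is the identity on the cone of `u`. -/
def IsGood (f : Perm (Cantor n)) (u : List (Fin n)) : Prop :=
  (∃ k > 0, Replaces (f ^ k) u u) ∧ ∀ k : ℤ, ∃ v, Replaces (f ^ k) u v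

/-- Good words no proper prefix of which is good. Their cones partition the set of torsion points,
and `f` permutes them. -/
def minimalGood (f : Perm (Cantor n)) : Set (List (Fin n)) :=
  {u | IsGood f u ∧ ∀ s t, u = s ++ t → IsGood f s → t = []}

variable {f : Perm (Cantor n)} {u v : List (Fin n)} {x : Cantor n}

theorem Replaces.zpow {u : List (Fin n)} (h : Replaces f u u) (k : ℤ) : Replaces (f ^ k) u u := by
  cases k with
  | ofNat k => exact h.pow k
  | negSucc k => exact (h.pow (k + 1)).inv

theorem exists_isGood (hf : f ∈ localPerm n) (hx : IsTorsionAt f x) :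
    ∃ u, x ∈ cone u ∧ IsGood f u := by
  obtain ⟨k, hk, u, hxu, hu⟩ := hx
  have h : ∀ j, ∃ D, ∀ u : List (Fin n), D ≤ u.length → ∃ v, Replaces (f ^ j) u v := fun j =>
    exists_forall_replaces (pow_mem hf j)
  choose D hD using h
  obtain ⟨t, ht⟩ := exists_eq_append_of_mem_cone hxu
    (mem_cone_pre x (u.length + (Finset.range k).sup D)) (by simp)
  have hu' := hu.append t
  rw [← ht] at hu'
  refine ⟨_, mem_cone_pre x _, ⟨k, hk, hu'⟩, fun m => ?_⟩
  have hk' : (0 : ℤ) < k := by exact_mod_cast hk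
  obtain ⟨j, hj⟩ := Int.eq_ofNat_of_zero_le (Int.emod_nonneg m hk'.ne')
  have hjk : j < k := by have := Int.emod_lt_of_pos m hk'; omega
  obtain ⟨v, hv⟩ := hD j (pre x (u.length + (Finset.range k).sup D)) (by
    have := Finset.le_sup (f := D) (Finset.mem_range.2 hjk)
    rw [length_pre]; omega)
  refine ⟨v, ?_⟩
  rw [← Int.emod_add_mul_ediv m k, zpow_add, hj, zpow_natCast, zpow_mul,
    zpow_natCast]
  exact hv.mul (hu'.zpow _)

theorem IsGood.append (h : IsGood f u) (t : List (Fin n)) : IsGood f (u ++ t) := by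
  obtain ⟨⟨k, hk, hu⟩, h⟩ := h
  exact ⟨⟨k, hk, hu.append t⟩, fun j => (h j).imp' (· ++ t) fun _ hv => hv.append t⟩

theorem IsGood.isTorsionAt (h : IsGood f u) (hx : x ∈ cone u) : IsTorsionAt f x := by
  obtain ⟨⟨k, hk, hu⟩, -⟩ := h
  exact ⟨k, hk, u, hx, hu⟩

theorem IsGood.map (h : IsGood f u) {j : ℤ} (hv : Replaces (f ^ j) u v) : IsGood f v := by
  obtain ⟨⟨k, hk, hu⟩, h⟩ := h
  refine ⟨⟨k, hk, ?_⟩, fun l => ?_⟩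
  · have := hv.mul (hu.mul hv.inv)
    rwa [← zpow_natCast, ← zpow_neg, ← zpow_add, ← zpow_add,
      show j + ((k : ℤ) + -j) = k by ring, zpow_natCast] at this
  · obtain ⟨w, hw⟩ := h (l + j)
    have := hw.mul hv.inv
    rw [← zpow_neg, ← zpow_add, add_neg_cancel_right] at this
    exact ⟨w, this⟩

theorem exists_mem_minimalGood (hf : f ∈ localPerm n) (hx : IsTorsionAt f x) :
    ∃ u ∈ minimalGood f, x ∈ cone u := by
  obtain ⟨u, ⟨hxu, hu⟩, hmin⟩ := exists_minimalFor_of_wellFoundedLT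
    (fun u => x ∈ cone u ∧ IsGood f u) List.length (exists_isGood hf hx)
  refine ⟨u, ⟨hu, ?_⟩, hxu⟩
  rintro s t rfl hs
  have := hmin ⟨cone_append_subset s t hxu, hs⟩ (by simp)
  rw [List.length_append] at this
  exact List.length_eq_zero_iff.1 (by omega)

theorem eq_of_mem_minimalGood (hu : u ∈ minimalGood f) (hv : v ∈ minimalGood f) (hxu : x ∈ cone u)
    (hxv : x ∈ cone v) : u = v := by
  wlog h : u.length ≤ v.length generalizing u v
  · exact (this hv hu hxv hxu (by omega)).symm
  obtain ⟨t, rfl⟩ := exists_eq_append_of_mem_cone hxu hxv h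
  rw [hv.2 u t rfl hu.1, List.append_nil]

section Nontrivial

variable [Nontrivial (Fin n)]

theorem map_mem_minimalGood (hu : u ∈ minimalGood f) (hv : Replaces f u v) :
    v ∈ minimalGood f := by
  have hv' : Replaces (f ^ (1 : ℤ)) u v := by rwa [zpow_one]
  refine ⟨hu.1.map hv', ?_⟩
  rintro s t rfl hs
  obtain ⟨s', hs'⟩ := hs.2 (-1)
  have h1 := hs'.append t
  rw [zpow_neg_one] at h1
  exact hu.2 s' t (hv.inv.unique h1) (hs.map hs')

theorem finite_minimalGood (hf : f ∈ localPerm n) : (minimalGood f).Finite := by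
  obtain ⟨D, hD⟩ : ∃ D, ∀ u : List (Fin n), D ≤ u.length →
      IsGood f u ∨ ∀ x ∈ cone u, ¬ IsTorsionAt f x := by
    refine exists_length_forall _ ?_ fun x => ?_
    · rintro u t (h | h)
      · exact .inl (h.append t)
      · exact .inr fun x hx => h x (cone_append_subset u t hx)
    · by_cases hx : IsTorsionAt f x
      · obtain ⟨u, hxu, hu⟩ := exists_isGood hf hx
        exact ⟨u, hxu, .inl hu⟩
      · obtain ⟨u, hxu, hu⟩ := exists_cone_of_not_isTorsionAt hf hx
        exact ⟨u, hxu, .inr hu⟩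
  refine (List.finite_length_le (Fin n) D).subset fun u hu => ?_
  by_contra hlt
  have hlt : D < u.length := not_le.1 hlt
  have hgood : IsGood f (u.take D) := by
    refine (hD (u.take D) (by simp; omega)).resolve_right fun h => ?_
    obtain ⟨x, hx, -⟩ := exists_ne_mem_cone u
    refine h x ?_ (hu.1.isTorsionAt hx)
    rw [← List.take_append_drop D u] at hx
    exact cone_append_subset _ _ hx
  have := congrArg List.length (hu.2 _ _ (List.take_append_drop D u).symm hgood)
  simp at this
  omega

/-- The torsion part of `f` is the product of the finite set of minimal good words and the Cantor
set, and `f` acts on it by a permutation of the first factor. -/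
theorem exists_equiv_torsion (hf : f ∈ localPerm n) :
    ∃ (a : Perm (minimalGood f)) (e : minimalGood f × Cantor n ≃ {x // IsTorsionAt f x}),
      (∀ p, (e p : Cantor n) = prepend p.1 p.2) ∧
      ∀ (k : ℤ) p, (e (turn a k p) : Cantor n) = (f ^ k) (e p) := by
  have : Finite (minimalGood f) := (finite_minimalGood hf).to_subtype
  have hmap : ∀ m : minimalGood f, ∃ v : minimalGood f, Replaces f m v := by
    rintro ⟨m, hm⟩
    obtain ⟨v, hv⟩ := hm.1.2 1
    rw [zpow_one] at hv
    exact ⟨⟨v, map_mem_minimalGood hm hv⟩, hv⟩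
  choose a ha using hmap
  have hinj : Function.Injective a := fun m m' h =>
    Subtype.ext ((ha m).unique_left (h ▸ ha m'))
  let a' : Perm (minimalGood f) := Equiv.ofBijective a (Finite.injective_iff_bijective.1 hinj)
  let e₀ : minimalGood f × Cantor n → {x // IsTorsionAt f x} := fun p =>
    ⟨prepend p.1 p.2, p.1.2.1.isTorsionAt (prepend_mem_cone _ _)⟩
  have he₀ : Function.Bijective e₀ := by
    constructor
    · rintro ⟨m, z⟩ ⟨m', z'⟩ h
      have h1 : prepend m.1 z = prepend m'.1 z' := congrArg Subtype.val h
      obtain rfl : m = m' := Subtype.ext (eq_of_mem_minimalGood m.2 m'.2 (prepend_mem_cone _ z)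
        (h1 ▸ prepend_mem_cone _ z'))
      rw [prepend_injective _ h1]
    · rintro ⟨x, hx⟩
      obtain ⟨u, hu, z, rfl⟩ := exists_mem_minimalGood hf hx
      exact ⟨(⟨u, hu⟩, z), rfl⟩
  have hstep : ∀ p, (e₀ (turn a' 1 p) : Cantor n) = f (e₀ p) := fun p => (ha p.1 p.2).symm
  refine ⟨a', Equiv.ofBijective e₀ he₀, fun p => rfl, fun k p => ?_⟩
  change (e₀ (turn a' k p) : Cantor n) = (f ^ k) (e₀ p)
  induction k using Int.induction_on with
  | zero => rfl
  | succ i ih => rw [add_comm, ← turn_turn, hstep, ih, zpow_add, zpow_one, Perm.mul_apply]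
  | pred i ih =>
    refine f.injective ?_
    rw [← hstep, turn_turn, add_sub_cancel, ih, ← Perm.mul_apply, ← zpow_one_add, add_sub_cancel]

theorem fg_torsionCentralizer (hf : f ∈ localPerm n) : (torsionCentralizer f).FG := by
  classical
  have : Finite (minimalGood f) := (finite_minimalGood hf).to_subtype
  obtain ⟨a, e, he, hturn⟩ := exists_equiv_torsion hf
  let Θ := Perm.extendDomainHom e
  have hΘ : ∀ g p, Θ g (e p) = e (g p) := fun g p => Perm.extendDomain_apply_image g e p
  have hΘ' : ∀ g x, ¬ IsTorsionAt f x → Θ g x = x := fun g x hx =>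
    Perm.extendDomain_apply_not_subtype g e hx
  have hpoint : ∀ (u : Node (minimalGood f) n) z, (e (u.point z) : Cantor n) =
      prepend (u.1.1 ++ u.2) z := fun u z => by
    rw [he, prepend_append]; rfl
  have hmap : (equivariantPerm n a).map Θ = torsionCentralizer f := by
    refine le_antisymm ?_ fun γ hγ => ?_
    · rintro _ ⟨g, hg, rfl⟩
      refine ⟨⟨fun x => ?_, Equiv.ext fun x => ?_⟩, hΘ' g⟩
      · by_cases hx : IsTorsionAt f x
        · obtain ⟨p, hp⟩ := e.surjective ⟨x, hx⟩
          obtain ⟨u, v, ⟨z, rfl⟩, hu⟩ := hg.1 p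
          have hpx : (e (u.point z) : Cantor n) = x := congrArg Subtype.val hp
          refine ⟨u.1.1 ++ u.2, v.1.1 ++ v.2, ⟨z, by rw [← hpoint, hpx]⟩, fun y => ?_⟩
          rw [← hpoint, hΘ, hu, hpoint]
        · obtain ⟨u, hxu, hu⟩ := exists_cone_of_not_isTorsionAt hf hx
          exact ⟨u, u, hxu, fun z => hΘ' g _ (hu _ (prepend_mem_cone u z))⟩
      · rw [Perm.mul_apply, Perm.mul_apply]
        by_cases hx : IsTorsionAt f x
        · obtain ⟨p, hp⟩ := e.surjective ⟨x, hx⟩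
          have hpx : (e p : Cantor n) = x := congrArg Subtype.val hp
          have h1 := fun p => hturn 1 p
          simp only [zpow_one] at h1
          rw [← hpx, hΘ, ← h1, ← h1, hΘ, hg.2]
        · rw [hΘ' g x hx, hΘ' g _ fun h => hx ((isTorsionAt_apply_iff hf (Commute.refl f)).1 h)]
    · have hpres : ∀ x, IsTorsionAt f (γ x) ↔ IsTorsionAt f x := fun x =>
        isTorsionAt_apply_iff hγ.1.1 hγ.1.2
      let g : Perm (minimalGood f × Cantor n) := e.symm.permCongr (γ.subtypePerm hpres)
      have hg : ∀ p, (e (g p) : Cantor n) = γ (e p) := fun p => by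
        simp [g, Equiv.permCongr_apply]
      have hinj : ∀ {p q}, (e p : Cantor n) = e q → p = q := fun h => e.injective (Subtype.ext h)
      refine ⟨g, ⟨fun p => ?_, fun k p => hinj ?_⟩, Equiv.ext fun x => ?_⟩
      · obtain ⟨u, v, hpu, hu⟩ := hγ.1.1 (e p)
        -- replace `u` and `v` by extensions that are longer than the minimal good words
        obtain ⟨z, hz⟩ := hpu
        set t := pre z (p.1.1.length + (g p).1.1.length) with ht
        obtain ⟨y, hy⟩ : z ∈ cone t := mem_cone_pre _ _
        have hpt : (e p : Cantor n) ∈ cone (u ++ t) := ⟨y, by rw [prepend_append, hy, hz]⟩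
        have hut := hu.append t
        have hgt : (e (g p) : Cantor n) ∈ cone (v ++ t) := hg p ▸ hut.mem_cone hpt
        obtain ⟨w, hw⟩ := exists_eq_append_of_mem_cone
          (show (e p : Cantor n) ∈ cone p.1.1 from he p ▸ prepend_mem_cone _ _) hpt
          (by rw [List.length_append, ht, length_pre]; omega)
        obtain ⟨w', hw'⟩ := exists_eq_append_of_mem_cone
          (show (e (g p) : Cantor n) ∈ cone (g p).1.1 from he (g p) ▸ prepend_mem_cone _ _) hgt
          (by rw [List.length_append, ht, length_pre]; omega)
        refine ⟨(p.1, w), ((g p).1, w'), ⟨y, hinj ?_⟩, fun y => hinj ?_⟩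
        · rw [hpoint, ← hw, prepend_append, hy, hz]
        · rw [hg, hpoint, hpoint, ← hw, ← hw', hut]
      · rw [hg, hturn, hturn, hg, ← Perm.mul_apply, (hγ.1.2.zpow_right k).eq, Perm.mul_apply]
      · by_cases hx : IsTorsionAt f x
        · obtain ⟨p, hp⟩ := e.surjective ⟨x, hx⟩
          have hpx : (e p : Cantor n) = x := congrArg Subtype.val hp
          rw [← hpx, hΘ, hg]
        · rw [hΘ' g x hx, hγ.2 x hx]
  obtain ⟨S, hS⟩ := fg_equivariantPerm (n := n) a
  exact ⟨S.image Θ, by rw [Finset.coe_image, ← MonoidHom.map_closure, hS, hmap]⟩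

end Nontrivial

/-! ### Homeomorphisms -/

theorem continuous_prepend (u : List (Fin n)) : Continuous (prepend u) := by
  induction u with
  | nil => exact continuous_id
  | cons i u ih =>
    refine continuous_pi fun k => ?_
    cases k with
    | zero => exact continuous_const
    | succ k => exact (continuous_apply k).comp ih

theorem isOpen_cone (u : List (Fin n)) : IsOpen (cone u) := by
  induction u with
  | nil =>
    convert isOpen_univ
    exact Set.eq_univ_of_forall fun x => ⟨x, rfl⟩
  | cons i u ih =>
    have : cone (i :: u) = (fun x : Cantor n => x 0) ⁻¹' {i} ∩
        (fun (x : Cantor n) k => x (k + 1)) ⁻¹' cone u := by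
      ext x
      constructor
      · rintro ⟨z, rfl⟩
        exact ⟨rfl, z, rfl⟩
      · rintro ⟨rfl, z, hz⟩
        exact ⟨z, by rw [prepend, hz, cons_eta]⟩
    rw [this]
    exact ((isOpen_discrete _).preimage (continuous_apply 0)).inter
      (ih.preimage (continuous_pi fun k => continuous_apply (k + 1)))

theorem continuous_of_mem_localPerm {g : Perm (Cantor n)} (hg : g ∈ localPerm n) :
    Continuous g := by
  refine continuous_iff_continuousAt.2 fun x => ?_
  obtain ⟨u, v, hx, hu⟩ := hg x
  have hcont : Continuous fun (y : Cantor n) k => y (u.length + k) :=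
    continuous_pi fun k => continuous_apply _
  refine (((continuous_prepend v).comp hcont).continuousAt).congr ?_
  filter_upwards [(isOpen_cone u).mem_nhds hx]
  rintro _ ⟨z, rfl⟩
  rw [hu, Function.comp_apply]
  exact congrArg _ (funext fun k => prepend_apply_of_le u z k)

theorem toEquiv_mem_localPerm (α : V n) : α.1.toEquiv ∈ localPerm n := by
  obtain ⟨P, hP⟩ := α.2
  intro x
  obtain ⟨u, v, y, hx, hu⟩ := hP.isLocal x
  exact ⟨u, v, ⟨y, hx.symm⟩, hu⟩

/-- A local permutation of the Cantor set, as an element of the Higman-Thompson group. -/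
def ofLocalPerm (g : Perm (Cantor n)) (hg : g ∈ localPerm n) : V n :=
  ⟨⟨g, continuous_of_mem_localPerm hg, continuous_of_mem_localPerm (inv_mem hg)⟩, by
    refine IsLocal.exists_represents fun x => ?_
    obtain ⟨u, v, ⟨y, hy⟩, hu⟩ := hg x
    exact ⟨u, v, y, hy.symm, hu⟩⟩

theorem V_ext {α β : V n} (h : α.1.toEquiv = β.1.toEquiv) : α = β :=
  Subtype.ext (Homeomorph.toEquiv_injective h)

theorem fg_centralizer [Nontrivial (Fin n)] (α : V n) :
    Group.FG (Subgroup.centralizer ({α} : Set (V n))) := by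
  have hα := toEquiv_mem_localPerm α
  have hfg := (Group.fg_iff_subgroup_fg _).2 (fg_localCentralizer hα (fg_torsionCentralizer hα))
  let Φ : localCentralizer α.1.toEquiv →* Subgroup.centralizer ({α} : Set (V n)) :=
    { toFun := fun g => ⟨ofLocalPerm g.1 g.2.1,
        Subgroup.mem_centralizer_singleton_iff.2 (V_ext g.2.2.eq)⟩
      map_one' := rfl
      map_mul' := fun _ _ => rfl }
  refine Group.fg_of_surjective (f := Φ) fun β => ?_
  exact ⟨⟨β.1.1.toEquiv, toEquiv_mem_localPerm β.1,
    congrArg (fun γ : V n => γ.1.toEquiv) (Subgroup.mem_centralizer_singleton_iff.1 β.2)⟩, rfl⟩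

end HigmanThompson

/-- For `n > 1` and `α ∈ V_n`, the centralizer of `α` in `V_n` is finitely generated. -/
theorem corollary1p2 (n : ℕ) (hn : 1 < n) (α : HigmanThompson.V n) :
    Group.FG (Subgroup.centralizer ({α} : Set (HigmanThompson.V n))) := by
  have : Nontrivial (Fin n) := Fin.nontrivial_iff_two_le.2 hn
  exact HigmanThompson.fg_centralizer α
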